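/- Let $k$ be an algebraically closed field of characteristic zero, and for $N\ge 1$ let $D_N$ denote the dihedral group of order $2N$ (so $D_1\cong C_2$). Let $n,m$ be odd positive integers, let $H_1,H_2\subset \mathrm{PGL}_2(k)$ be subgroups with $H_1\cong D_n$ and $H_2\cong D_m$, let $\alpha\colon H_1\to Q$ and $\beta\colon H_2\to Q$ be surjective homomorphisms onto a group $Q$, and let $$G=H_1\times_Q H_2=\{(h_1,h_2)\in H_1\times H_2 : \alpha(h_1)=\beta(h_2)\}\subset \mathrm{PGL}_2(k)\times\mathrm{PGL}_2(k),$$ acting factorwise on $\mathbb P^1\times\mathbb P^1$. Suppose that $G$ is isomorphic to a dihedral group $D_N$ for some $N\ge 1$. Then $G$ is linearizable, that is, there is a birational map $\psi\colon \mathbb P^1\times\mathbb P^1\dashrightarrow\mathbb P^2$ such that $\psi G\psi^{-1}\subset\mathrm{Aut}(\mathbb P^2)\cong\mathrm{PGL}_3(k)$. -/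

import Mathlib

open scoped LinearAlgebra.Projectivization MatrixGroups

/-- A group is dihedral if it is isomorphic to `D_N`, the dihedral group of order `2N`,
for some `N ≥ 1`. -/
def IsDihedral (G : Type*) [Group G] : Prop :=
  ∃ N : ℕ, 1 ≤ N ∧ Nonempty (G ≃* DihedralGroup N)

/-- For subgroups `H₁ ≤ Γ₁`, `H₂ ≤ Γ₂` and homomorphisms `α : H₁ → Q`, `β : H₂ → Q`, the fibre
product `H₁ ×_Q H₂ = {(h₁, h₂) ∈ H₁ × H₂ | α h₁ = β h₂}`, as a subgroup of `Γ₁ × Γ₂`. -/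
def fibreProduct {Γ₁ Γ₂ Q : Type*} [Group Γ₁] [Group Γ₂] [Group Q]
    {H₁ : Subgroup Γ₁} {H₂ : Subgroup Γ₂} (α : H₁ →* Q) (β : H₂ →* Q) : Subgroup (Γ₁ × Γ₂) :=
  Subgroup.map (H₁.subtype.prodMap H₂.subtype)
    (MonoidHom.eqLocus (α.comp (MonoidHom.fst H₁ H₂)) (β.comp (MonoidHom.snd H₁ H₂)))

/-! ### Zariski open sets and regular maps

Here `X` is (the set of points of) a variety with (multi)homogeneous coordinates: `c x : σ → k`
is a choice of coordinates of the point `x`, and `w : σ → M` gives the (multi)degrees of the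
coordinates. It is used only for the two coordinate systems `Plane.coord` and `Quadric.coord`
below. All conditions involve only (multi)homogeneous polynomials, hence do not depend on the
chosen representatives of the points. -/

section Regular

variable {k : Type*} [Field k] {X σ M : Type*} [AddCommMonoid M]

/-- `U` is Zariski open: it is the complement of the common zero locus of a set of
(multi)homogeneous polynomials. -/
def IsZariskiOpen (c : X → σ → k) (w : σ → M) (U : Set X) : Prop :=
  ∃ S : Set (MvPolynomial σ k),
    (∀ F ∈ S, ∃ e : M, MvPolynomial.IsWeightedHomogeneous w F e) ∧
    U = {x | ∃ F ∈ S, MvPolynomial.eval (c x) F ≠ 0}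

/-- `f` restricted to `U` is a regular map to the projective space `ℙ^d`: near each point of `U`
it is of the form `[F₀ : ⋯ : F_d]`, where the `F_i` are (multi)homogeneous polynomials of
the same (multi)degree which do not all vanish at that point. -/
def IsRegularMapOn (c : X → σ → k) (w : σ → M) {d : ℕ} (f : X → ℙ k (Fin (d + 1) → k))
    (U : Set X) : Prop :=
  ∀ x ∈ U, ∃ (e : M) (F : Fin (d + 1) → MvPolynomial σ k),
    (∀ i, MvPolynomial.IsWeightedHomogeneous w (F i) e) ∧
    (fun i => MvPolynomial.eval (c x) (F i)) ≠ 0 ∧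
    ∀ y ∈ U, ∀ h : (fun i => MvPolynomial.eval (c y) (F i)) ≠ 0,
      f y = Projectivization.mk k (fun i => MvPolynomial.eval (c y) (F i)) h

end Regular

/-- The points of the projective plane `ℙ²` over `k`. -/
abbrev Plane (k : Type*) [Field k] : Type _ := ℙ k (Fin 3 → k)

/-- The points of the quadric surface `ℙ¹ × ℙ¹` over `k`. -/
abbrev Quadric (k : Type*) [Field k] : Type _ := ℙ k (Fin 2 → k) × ℙ k (Fin 2 → k)

/-- Homogeneous coordinates `z₀, z₁, z₂` of a point of `ℙ²`. -/
noncomputable def Plane.coord {k : Type*} [Field k] (p : Plane k) : Fin 3 → k := p.rep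

/-- Each `z_i` has degree `1`. -/
def Plane.degree : Fin 3 → ℕ := fun _ => 1

/-- Bihomogeneous coordinates `x₀, x₁; y₀, y₁` of a point of `ℙ¹ × ℙ¹`. -/
noncomputable def Quadric.coord {k : Type*} [Field k] (p : Quadric k) : Fin 2 ⊕ Fin 2 → k :=
  Sum.elim p.1.rep p.2.rep

/-- Each `x_i` has bidegree `(1, 0)` and each `y_i` has bidegree `(0, 1)`. -/
def Quadric.degree : Fin 2 ⊕ Fin 2 → ℕ × ℕ := Sum.elim (fun _ => (1, 0)) (fun _ => (0, 1))

/-- The action of `PGL₂(k) × PGL₂(k)` on `ℙ¹ × ℙ¹`, factor by factor. -/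
noncomputable def Quadric.act {k : Type*} [Field k] (g : PGL(2, k) × PGL(2, k)) (p : Quadric k) :
    Quadric k :=
  (g.1 • p.1, g.2 • p.2)

/-- A birational map `ψ : ℙ¹ × ℙ¹ ⇢ ℙ²`, given as an isomorphism (a bijection which is regular
in both directions) from a nonempty Zariski open subset of `ℙ¹ × ℙ¹` onto a Zariski open
subset of `ℙ²`. -/
structure IsBirational {k : Type*} [Field k] (ψ : PartialEquiv (Quadric k) (Plane k)) : Prop where
  source_nonempty : ψ.source.Nonempty
  source_open : IsZariskiOpen Quadric.coord Quadric.degree ψ.source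
  target_open : IsZariskiOpen Plane.coord Plane.degree ψ.target
  regular : IsRegularMapOn Quadric.coord Quadric.degree ψ ψ.source
  regular_symm_fst : IsRegularMapOn Plane.coord Plane.degree (fun z => (ψ.symm z).1) ψ.target
  regular_symm_snd : IsRegularMapOn Plane.coord Plane.degree (fun z => (ψ.symm z).2) ψ.target

/-- A group `G` acting on `ℙ¹ × ℙ¹` through `PGL₂(k) × PGL₂(k)` is linearizable if there is a
birational map `ψ : ℙ¹ × ℙ¹ ⇢ ℙ²` with `ψ ∘ G ∘ ψ⁻¹ ⊆ Aut(ℙ²) = PGL₃(k)`. The identity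
`ψ ∘ g = A ∘ ψ` of rational maps is expressed at the points `p` such that `ψ` is defined at `p`
and at `g p`; for `k` infinite these form a dense Zariski open set. -/
def IsLinearizable {k : Type*} [Field k] (G : Subgroup (PGL(2, k) × PGL(2, k))) : Prop :=
  ∃ ψ : PartialEquiv (Quadric k) (Plane k), IsBirational ψ ∧
    ∀ g ∈ G, ∃ A : PGL(3, k), ∀ p ∈ ψ.source, Quadric.act g p ∈ ψ.source →
      ψ (Quadric.act g p) = A • ψ p

/-! An element of odd order in PGL₂ together with an involution inverting it becomes x ↦ ζx, x ↦ 1/x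
in a suitable coordinate (`exists_actsAs_dihedral`). Suppose n, m ≠ 1. The projections of G to the
two dihedral groups are onto, and a surjection onto a nonabelian dihedral group of odd degree
respects rotations and reflections (`surjective_dihedralGroup_hom`). So G is generated by (x, y) ↦
(ζ₁x, ζ₂y) and (x, y) ↦ (1/x, 1/y). Both ζ's are powers of one root of unity, so a unimodular
monomial change X = x^p y^q, Y = x^r y^s makes Y invariant under the rotation
(`exists_unimodular_of_roots_of_unity`): the generators become (ηX, Y) and (1/X, 1/Y), with η^(2M+1)
= 1 for 2M+1 = nm.

To linearize this action, look for affine coordinates a, b with a/b = X on which the rotation is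
diag(η^(M+1), η^M) and the reflection swaps a and b. The function S = (a^(2M+1) - b^(2M+1))/(ab)^M
is rotation invariant, changes sign under the swap, and is homogeneous of degree 1; oddness of nm is
what makes degree 1 possible. The function (Y-1)/(Y+1) transforms in the same way, so one may impose
S = (Y-1)/(Y+1). Having degree 1, this equation determines the scale b uniquely and rationally from
X and Y, so (X, Y) ↦ (a, b) is birational and equivariant (`isBirational_linearization`,
`isLinearizable_of_monomial_action`).

If n = 1 or m = 1, no monomial change beyond a permutation and inversion of coordinates is needed:
the factor of order 2 acts on its coordinate Y by Y ↦ Y^(±1), independently of X. The same map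
works, because inverting X alone or Y alone is also linear in a, b up to signs. -/

/-! ### Quotients of multihomogeneous polynomials and their nonvanishing loci. -/

section RationalFunctions

open MvPolynomial

variable {k : Type*} [Field k] {X σ M : Type*} [AddCommMonoid M]
  {c : X → σ → k} {w : σ → M} {U V : Set X} {f g : X → k}

/-- `U` is the complement of the zero locus of a single (multi)homogeneous polynomial. -/
def IsPrincipalOpen (c : X → σ → k) (w : σ → M) (U : Set X) : Prop :=
  ∃ (e : M) (F : MvPolynomial σ k), IsWeightedHomogeneous w F e ∧ U = {x | eval (c x) F ≠ 0}

/-- On `U`, the function `f` is a quotient of (multi)homogeneous polynomials of the same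
(multi)degree with nonvanishing denominator. -/
def IsRatioOn (c : X → σ → k) (w : σ → M) (U : Set X) (f : X → k) : Prop :=
  ∃ (e : M) (P D : MvPolynomial σ k), IsWeightedHomogeneous w P e ∧ IsWeightedHomogeneous w D e ∧
    ∀ x ∈ U, eval (c x) D ≠ 0 ∧ f x = eval (c x) P / eval (c x) D

theorem IsPrincipalOpen.isZariskiOpen (h : IsPrincipalOpen c w U) : IsZariskiOpen c w U := by
  obtain ⟨e, F, hF, rfl⟩ := h
  exact ⟨{F}, by simpa using ⟨e, hF⟩, by simp⟩

/-- The denominator of f has no zero on U, so multiplying the equation of U by the numerator cuts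
out the smaller set. Successive use shows that the source and target of the birational map are open.
-/
theorem IsPrincipalOpen.inter_ne_zero (hU : IsPrincipalOpen c w U) (hf : IsRatioOn c w U f) :
    IsPrincipalOpen c w (U ∩ {x | f x ≠ 0}) := by
  obtain ⟨e, F, hF, rfl⟩ := hU
  obtain ⟨e', P, D, hP, hD, h⟩ := hf
  refine ⟨_, _, hF.mul hP, ?_⟩
  ext x
  simp only [Set.mem_inter_iff, Set.mem_ofPred_eq, map_mul, mul_ne_zero_iff]
  refine and_congr_right fun hx => ?_
  rw [(h x hx).2]
  simp [(h x hx).1]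

namespace IsRatioOn

theorem mono (hf : IsRatioOn c w V f) (h : U ⊆ V) : IsRatioOn c w U f := by
  obtain ⟨e, P, D, hP, hD, H⟩ := hf
  exact ⟨e, P, D, hP, hD, fun x hx => H x (h hx)⟩

theorem congr (hf : IsRatioOn c w U f) (h : ∀ x ∈ U, g x = f x) : IsRatioOn c w U g := by
  obtain ⟨e, P, D, hP, hD, H⟩ := hf
  exact ⟨e, P, D, hP, hD, fun x hx => ⟨(H x hx).1, (h x hx).trans (H x hx).2⟩⟩

theorem const (a : k) : IsRatioOn c w U fun _ => a :=
  ⟨0, C a, C 1, isWeightedHomogeneous_C w a, isWeightedHomogeneous_C w 1, by simp⟩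

theorem mul (hf : IsRatioOn c w U f) (hg : IsRatioOn c w U g) :
    IsRatioOn c w U fun x => f x * g x := by
  obtain ⟨e, P, D, hP, hD, H⟩ := hf
  obtain ⟨e', P', D', hP', hD', H'⟩ := hg
  refine ⟨_, _, _, hP.mul hP', hD.mul hD', fun x hx => ?_⟩
  obtain ⟨h1, h2⟩ := H x hx
  obtain ⟨h3, h4⟩ := H' x hx
  simp only [map_mul, h2, h4]
  exact ⟨mul_ne_zero h1 h3, by field_simp⟩

theorem add (hf : IsRatioOn c w U f) (hg : IsRatioOn c w U g) :
    IsRatioOn c w U fun x => f x + g x := by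
  obtain ⟨e, P, D, hP, hD, H⟩ := hf
  obtain ⟨e', P', D', hP', hD', H'⟩ := hg
  refine ⟨_, _, _, (hP.mul hD').add (hD.mul hP'), hD.mul hD', fun x hx => ?_⟩
  obtain ⟨h1, h2⟩ := H x hx
  obtain ⟨h3, h4⟩ := H' x hx
  simp only [map_mul, map_add, h2, h4]
  exact ⟨mul_ne_zero h1 h3, by field_simp⟩

theorem sub (hf : IsRatioOn c w U f) (hg : IsRatioOn c w U g) :
    IsRatioOn c w U fun x => f x - g x :=
  (hf.add ((const (-1)).mul hg)).congr fun x _ => by ring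

theorem inv (hf : IsRatioOn c w U f) (h : ∀ x ∈ U, f x ≠ 0) :
    IsRatioOn c w U fun x => (f x)⁻¹ := by
  obtain ⟨e, P, D, hP, hD, H⟩ := hf
  refine ⟨e, D, P, hD, hP, fun x hx => ⟨fun h0 => h x hx ?_, ?_⟩⟩
  · rw [(H x hx).2, h0, zero_div]
  · simp only [(H x hx).2, inv_div]

theorem div (hf : IsRatioOn c w U f) (hg : IsRatioOn c w U g) (h : ∀ x ∈ U, g x ≠ 0) :
    IsRatioOn c w U fun x => f x / g x := by
  simpa only [div_eq_mul_inv] using hf.mul (hg.inv h)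

theorem pow (hf : IsRatioOn c w U f) (n : ℕ) : IsRatioOn c w U fun x => f x ^ n := by
  induction n with
  | zero => simpa using const 1
  | succ n ih => simpa only [pow_succ] using ih.mul hf

theorem zpow (hf : IsRatioOn c w U f) (h : ∀ x ∈ U, f x ≠ 0) (n : ℤ) :
    IsRatioOn c w U fun x => f x ^ n := by
  obtain ⟨n, rfl | rfl⟩ := n.eq_nat_or_neg
  · simpa using hf.pow n
  · simpa using (hf.pow n).inv fun x hx => pow_ne_zero _ (h x hx)

/-- A map to projective space whose homogeneous coordinates are rational functions without
poles or common zeros is regular. -/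
theorem isRegularMapOn {d : ℕ} {f : X → ℙ k (Fin (d + 1) → k)} {φ : Fin (d + 1) → X → k}
    (hφ : ∀ i, IsRatioOn c w U (φ i))
    (hf : ∀ x ∈ U, ∃ h : (fun i => φ i x) ≠ 0, f x = Projectivization.mk k (fun i => φ i x) h) :
    IsRegularMapOn c w f U := by
  choose e P D hP hD H using hφ
  -- Clearing denominators: scaling all coordinates by the product of the D_j gives polynomials of
  -- the common degree ∑ e_j.
  have key : ∀ x ∈ U, (fun i => eval (c x) (P i * ∏ j ∈ Finset.univ.erase i, D j)) =
      (∏ j, eval (c x) (D j)) • fun i => φ i x := by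
    intro x hx
    funext i
    have h := H i x hx
    simp only [map_mul, map_prod, Pi.smul_apply, smul_eq_mul, h.2]
    rw [← Finset.mul_prod_erase _ _ (Finset.mem_univ i)]
    have := h.1
    field_simp
  have hne : ∀ x ∈ U, (∏ j, eval (c x) (D j)) ≠ 0 := fun x hx =>
    Finset.prod_ne_zero_iff.2 fun j _ => (H j x hx).1
  refine fun x hx => ⟨∑ j, e j, fun i => P i * ∏ j ∈ Finset.univ.erase i, D j, fun i => ?_, ?_, ?_⟩
  · rw [← Finset.add_sum_erase _ _ (Finset.mem_univ i)]
    exact (hP i).mul (IsWeightedHomogeneous.prod _ _ _ fun j _ => hD j)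
  · rw [key x hx]
    exact smul_ne_zero (hne x hx) (hf x hx).1
  · intro y hy h
    obtain ⟨h', hy'⟩ := hf y hy
    rw [hy', Projectivization.mk_eq_mk_iff']
    refine ⟨(∏ j, eval (c y) (D j))⁻¹, ?_⟩
    rw [key y hy, smul_smul, inv_mul_cancel₀ (hne y hy), one_smul]

end IsRatioOn

end RationalFunctions

/-! ### Affine coordinates on ℙ¹ and ℙ². -/

section Charts

open Matrix

variable {k : Type*} [Field k]

theorem gl_mulVec_ne_zero {n : Type*} [Fintype n] [DecidableEq n] (γ : GL n k) {v : n → k}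
    (hv : v ≠ 0) : γ.1 *ᵥ v ≠ 0 := by
  intro h
  apply hv
  have : γ⁻¹.1 *ᵥ (γ.1 *ᵥ v) = v := by
    rw [mulVec_mulVec, ← Units.val_mul, inv_mul_cancel, Units.val_one, one_mulVec]
  rw [← this, h, mulVec_zero]

/-- The affine coordinate on `ℙ¹` obtained from the linear forms given by the rows of `γ`. -/
noncomputable def coordRatio (γ : GL (Fin 2) k) (p : ℙ k (Fin 2 → k)) : k :=
  (γ.1 *ᵥ p.rep) 0 / (γ.1 *ᵥ p.rep) 1

/-- The complement of `{0, ∞}` in `ℙ¹` for the affine coordinate given by `γ`. -/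
def coordTorus (γ : GL (Fin 2) k) : Set (ℙ k (Fin 2 → k)) :=
  {p | (γ.1 *ᵥ p.rep) 0 ≠ 0 ∧ (γ.1 *ᵥ p.rep) 1 ≠ 0}

/-- The point of `ℙ¹` with a given value of the affine coordinate given by `γ`. -/
noncomputable def coordPoint (γ : GL (Fin 2) k) (x : k) : ℙ k (Fin 2 → k) :=
  Projectivization.mk k (γ⁻¹.1 *ᵥ ![x, 1]) (gl_mulVec_ne_zero _ fun h => by
    simpa using congrFun h 1)

theorem coordRatio_mk (γ : GL (Fin 2) k) {v : Fin 2 → k} (hv : v ≠ 0) :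
    coordRatio γ (Projectivization.mk k v hv) = (γ.1 *ᵥ v) 0 / (γ.1 *ᵥ v) 1 := by
  obtain ⟨a, ha⟩ := Projectivization.exists_smul_eq_mk_rep k v hv
  rw [coordRatio, ← ha, Units.smul_def, mulVec_smul, Pi.smul_apply, Pi.smul_apply, smul_eq_mul,
    smul_eq_mul, mul_div_mul_left _ _ a.ne_zero]

theorem mk_mem_coordTorus (γ : GL (Fin 2) k) {v : Fin 2 → k} (hv : v ≠ 0) :
    Projectivization.mk k v hv ∈ coordTorus γ ↔ (γ.1 *ᵥ v) 0 ≠ 0 ∧ (γ.1 *ᵥ v) 1 ≠ 0 := by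
  obtain ⟨a, ha⟩ := Projectivization.exists_smul_eq_mk_rep k v hv
  simp only [coordTorus, Set.mem_ofPred_eq, ← ha, Units.smul_def, mulVec_smul, Pi.smul_apply,
    smul_eq_mul, mul_ne_zero_iff, a.ne_zero, ne_eq, not_false_eq_true, true_and]

theorem gl_mulVec_inv_mulVec {n : Type*} [Fintype n] [DecidableEq n] (γ : GL n k) (v : n → k) :
    γ.1 *ᵥ (γ⁻¹.1 *ᵥ v) = v := by
  rw [mulVec_mulVec, ← Units.val_mul, mul_inv_cancel, Units.val_one, one_mulVec]

theorem gl_inv_mulVec_mulVec {n : Type*} [Fintype n] [DecidableEq n] (γ : GL n k) (v : n → k) :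
    γ⁻¹.1 *ᵥ (γ.1 *ᵥ v) = v := by
  rw [mulVec_mulVec, ← Units.val_mul, inv_mul_cancel, Units.val_one, one_mulVec]

theorem coordRatio_coordPoint (γ : GL (Fin 2) k) (x : k) : coordRatio γ (coordPoint γ x) = x := by
  rw [coordPoint, coordRatio_mk, gl_mulVec_inv_mulVec]
  simp

theorem coordPoint_mem_coordTorus (γ : GL (Fin 2) k) {x : k} (hx : x ≠ 0) :
    coordPoint γ x ∈ coordTorus γ := by
  rw [coordPoint, mk_mem_coordTorus, gl_mulVec_inv_mulVec]
  simpa using hx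

theorem coordRatio_ne_zero {γ : GL (Fin 2) k} {p : ℙ k (Fin 2 → k)} (hp : p ∈ coordTorus γ) :
    coordRatio γ p ≠ 0 :=
  div_ne_zero hp.1 hp.2

theorem coordPoint_coordRatio {γ : GL (Fin 2) k} {p : ℙ k (Fin 2 → k)} (hp : p ∈ coordTorus γ) :
    coordPoint γ (coordRatio γ p) = p := by
  conv_rhs => rw [← p.mk_rep]
  rw [coordPoint, Projectivization.mk_eq_mk_iff']
  refine ⟨((γ.1 *ᵥ p.rep) 1)⁻¹, ?_⟩
  have : ![coordRatio γ p, 1] = ((γ.1 *ᵥ p.rep) 1)⁻¹ • (γ.1 *ᵥ p.rep) := by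
    have := hp.2
    ext i
    fin_cases i
    · simp [coordRatio, div_eq_inv_mul]
    · exact (inv_mul_cancel₀ this).symm
  rw [this, mulVec_smul, gl_inv_mulVec_mulVec]

/-- The first affine coordinate on the plane. -/
noncomputable def Plane.affFst (z : Plane k) : k := z.rep 0 / z.rep 2

/-- The second affine coordinate on the plane. -/
noncomputable def Plane.affSnd (z : Plane k) : k := z.rep 1 / z.rep 2

/-- The point of the plane with given affine coordinates. -/
noncomputable def Plane.ofAff (a b : k) : Plane k :=
  Projectivization.mk k ![a, b, 1] fun h => by simpa using congrFun h 2

/-- The complement of the coordinate triangle in the plane. -/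
def Plane.torus (k : Type*) [Field k] : Set (Plane k) :=
  {z | z.rep 0 ≠ 0 ∧ z.rep 1 ≠ 0 ∧ z.rep 2 ≠ 0}

theorem Plane.affFst_ofAff (a b : k) : (Plane.ofAff a b).affFst = a := by
  obtain ⟨u, hu⟩ := Projectivization.exists_smul_eq_mk_rep k ![a, b, 1]
    (fun h => by simpa using congrFun h 2)
  simp [affFst, ofAff, ← hu, Units.smul_def]

theorem Plane.affSnd_ofAff (a b : k) : (Plane.ofAff a b).affSnd = b := by
  obtain ⟨u, hu⟩ := Projectivization.exists_smul_eq_mk_rep k ![a, b, 1]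
    (fun h => by simpa using congrFun h 2)
  simp [affSnd, ofAff, ← hu, Units.smul_def]

theorem Plane.ofAff_mem_torus {a b : k} (ha : a ≠ 0) (hb : b ≠ 0) :
    Plane.ofAff a b ∈ Plane.torus k := by
  obtain ⟨u, hu⟩ := Projectivization.exists_smul_eq_mk_rep k ![a, b, 1]
    (fun h => by simpa using congrFun h 2)
  simp [torus, ofAff, ← hu, Units.smul_def, ha, hb]

theorem Plane.ofAff_aff {z : Plane k} (hz : z ∈ Plane.torus k) :
    Plane.ofAff z.affFst z.affSnd = z := by
  conv_rhs => rw [← z.mk_rep]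
  rw [ofAff, Projectivization.mk_eq_mk_iff']
  refine ⟨(z.rep 2)⁻¹, ?_⟩
  have := hz.2.2
  ext i
  fin_cases i <;> simp [affFst, affSnd, div_eq_inv_mul, this]

end Charts

/-! ### Regularity of the affine coordinates and of their inverses. -/

section ChartRegularity

open Matrix MvPolynomial

variable {k : Type*} [Field k]

theorem isPrincipalOpen_planeTorus :
    IsPrincipalOpen Plane.coord Plane.degree (Plane.torus k) := by
  refine ⟨_, X 0 * (X 1 * X 2), (isWeightedHomogeneous_X _ _ _).mul
    ((isWeightedHomogeneous_X _ _ _).mul (isWeightedHomogeneous_X _ _ _)), ?_⟩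
  ext z
  simp [Plane.torus, Plane.coord]

theorem isRatioOn_affFst :
    IsRatioOn Plane.coord Plane.degree (Plane.torus k) Plane.affFst :=
  ⟨1, X 0, X 2, isWeightedHomogeneous_X _ _ _, isWeightedHomogeneous_X _ _ _, fun z hz => by
    simpa [Plane.affFst, Plane.coord] using hz.2.2⟩

theorem isRatioOn_affSnd :
    IsRatioOn Plane.coord Plane.degree (Plane.torus k) Plane.affSnd :=
  ⟨1, X 1, X 2, isWeightedHomogeneous_X _ _ _, isWeightedHomogeneous_X _ _ _, fun z hz => by
    simpa [Plane.affSnd, Plane.coord] using hz.2.2⟩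

/-- The product of the tori of the two factors of `ℙ¹ × ℙ¹`. -/
def quadricTorus (γ₁ γ₂ : GL (Fin 2) k) : Set (Quadric k) := coordTorus γ₁ ×ˢ coordTorus γ₂

theorem isWeightedHomogeneous_linearForm (γ : GL (Fin 2) k) (i : Fin 2)
    {σ M : Type*} [AddCommMonoid M] {w : σ → M} {e : M} (ι : Fin 2 → σ) (h : ∀ j, w (ι j) = e) :
    IsWeightedHomogeneous w (∑ j, C (γ.1 i j) * X (ι j)) e :=
  IsWeightedHomogeneous.sum _ _ _ fun j _ => by
    simpa [h j] using (isWeightedHomogeneous_X k w (ι j)).C_mul (γ.1 i j)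

theorem isPrincipalOpen_quadricTorus (γ₁ γ₂ : GL (Fin 2) k) :
    IsPrincipalOpen Quadric.coord Quadric.degree (quadricTorus γ₁ γ₂) := by
  have h1 := fun i => isWeightedHomogeneous_linearForm γ₁ i (w := Quadric.degree) (e := (1, 0))
    Sum.inl fun _ => rfl
  have h2 := fun i => isWeightedHomogeneous_linearForm γ₂ i (w := Quadric.degree) (e := (0, 1))
    Sum.inr fun _ => rfl
  refine ⟨_, _, ((h1 0).mul (h1 1)).mul ((h2 0).mul (h2 1)), ?_⟩
  ext p
  simp [quadricTorus, coordTorus, Quadric.coord, mulVec, dotProduct]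

theorem isRatioOn_coordRatio_fst (γ₁ γ₂ : GL (Fin 2) k) :
    IsRatioOn Quadric.coord Quadric.degree (quadricTorus γ₁ γ₂) fun p => coordRatio γ₁ p.1 := by
  have h1 := fun i => isWeightedHomogeneous_linearForm γ₁ i (w := Quadric.degree) (e := (1, 0))
    Sum.inl fun _ => rfl
  refine ⟨_, _, _, h1 0, h1 1, fun p hp => ?_⟩
  have := hp.1.2
  simpa [coordRatio, Quadric.coord, mulVec, dotProduct] using this

theorem isRatioOn_coordRatio_snd (γ₁ γ₂ : GL (Fin 2) k) :
    IsRatioOn Quadric.coord Quadric.degree (quadricTorus γ₁ γ₂) fun p => coordRatio γ₂ p.2 := by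
  have h1 := fun i => isWeightedHomogeneous_linearForm γ₂ i (w := Quadric.degree) (e := (0, 1))
    Sum.inr fun _ => rfl
  refine ⟨_, _, _, h1 0, h1 1, fun p hp => ?_⟩
  have := hp.2.2
  simpa [coordRatio, Quadric.coord, mulVec, dotProduct] using this

theorem IsRatioOn.isRegularMapOn_coordPoint {X σ M : Type*} [AddCommMonoid M] {c : X → σ → k}
    {w : σ → M} {U : Set X} {f : X → k} (hf : IsRatioOn c w U f) (γ : GL (Fin 2) k) :
    IsRegularMapOn c w (fun x => coordPoint γ (f x)) U := by
  refine IsRatioOn.isRegularMapOn (d := 1) (φ := fun i x => (γ⁻¹.1 *ᵥ ![f x, 1]) i) (fun i => ?_)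
    fun x _ => ⟨gl_mulVec_ne_zero _ fun h => by simpa using congrFun h 1, rfl⟩
  exact (((const (γ⁻¹.1 i 0)).mul hf).add (const (γ⁻¹.1 i 1))).congr fun x _ => by
    simp [mulVec, dotProduct]

theorem IsRatioOn.isRegularMapOn_ofAff {X σ M : Type*} [AddCommMonoid M] {c : X → σ → k}
    {w : σ → M} {U : Set X} {f g : X → k} (hf : IsRatioOn c w U f) (hg : IsRatioOn c w U g) :
    IsRegularMapOn c w (fun x => Plane.ofAff (f x) (g x)) U := by
  refine IsRatioOn.isRegularMapOn (d := 2) (φ := fun i x => ![f x, g x, 1] i) (fun i => ?_)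
    fun x _ => ⟨fun h => by simpa using congrFun h 2, rfl⟩
  fin_cases i
  · exact hf
  · exact hg
  · exact const 1

end ChartRegularity

/-! ### Monomial coordinates and the formulas for the linearizing map. -/

section MonomialCoordinates

variable {k : Type*} [Field k]

/-- The monomial `x ^ i * y ^ j` in the affine coordinates of `ℙ¹ × ℙ¹` given by `γ₁`, `γ₂`. -/
noncomputable def quadricMonomial (γ₁ γ₂ : GL (Fin 2) k) (i j : ℤ) (z : Quadric k) : k :=
  coordRatio γ₁ z.1 ^ i * coordRatio γ₂ z.2 ^ j

theorem quadricMonomial_ne_zero {γ₁ γ₂ : GL (Fin 2) k} {z : Quadric k}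
    (hz : z ∈ quadricTorus γ₁ γ₂) (i j : ℤ) : quadricMonomial γ₁ γ₂ i j z ≠ 0 :=
  mul_ne_zero (zpow_ne_zero _ (coordRatio_ne_zero hz.1)) (zpow_ne_zero _ (coordRatio_ne_zero hz.2))

theorem isRatioOn_quadricMonomial (γ₁ γ₂ : GL (Fin 2) k) (i j : ℤ) :
    IsRatioOn Quadric.coord Quadric.degree (quadricTorus γ₁ γ₂) (quadricMonomial γ₁ γ₂ i j) :=
  ((isRatioOn_coordRatio_fst γ₁ γ₂).zpow (fun _ hz => coordRatio_ne_zero hz.1) i).mul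
    ((isRatioOn_coordRatio_snd γ₁ γ₂).zpow (fun _ hz => coordRatio_ne_zero hz.2) j)

/-- The inverse of a unimodular monomial transformation. -/
theorem monomial_inverse {x y : k} (hx : x ≠ 0) (hy : y ≠ 0) {p q r s : ℤ}
    (h : p * s - q * r = 1) :
    (x ^ p * y ^ q) ^ s * (x ^ r * y ^ s) ^ (-q) = x ∧
      (x ^ p * y ^ q) ^ (-r) * (x ^ r * y ^ s) ^ p = y := by
  constructor
  · calc _ = x ^ (p * s + r * -q) * y ^ (q * s + s * -q) := by
          simp only [mul_zpow, ← zpow_mul, zpow_add₀ hx, zpow_add₀ hy]; ring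
      _ = x := by
          rw [show p * s + r * -q = 1 by linarith, show q * s + s * -q = 0 by ring]; simp
  · calc _ = x ^ (p * -r + r * p) * y ^ (q * -r + s * p) := by
          simp only [mul_zpow, ← zpow_mul, zpow_add₀ hx, zpow_add₀ hy]; ring
      _ = y := by
          rw [show p * -r + r * p = 0 by ring, show q * -r + s * p = 1 by linarith]; simp

/-- The second linear coordinate on the faithful two-dimensional representation of the dihedral
group, in terms of toric coordinates. -/
noncomputable def linearCoord (M : ℕ) (X Y : k) : k :=
  (Y - 1) / (Y + 1) * X ^ M / (X ^ (2 * M + 1) - 1)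

/-- The semi-invariant `(a ^ N - b ^ N) / (a * b) ^ M`, with `N = 2 * M + 1`. -/
noncomputable def semiInvariant (M : ℕ) (a b : k) : k :=
  (a ^ (2 * M + 1) - b ^ (2 * M + 1)) / (a * b) ^ M

/-- The semi-invariant has degree (2M+1) - 2M = 1, so at (tX, t) it equals t(X^(2M+1) - 1)/X^M;
`linearCoord` is the t solving the resulting linear equation. -/
theorem semiInvariant_linearCoord (M : ℕ) {X Y : k} (hX : X ≠ 0) (hX1 : X ^ (2 * M + 1) - 1 ≠ 0)
    (hY1 : Y - 1 ≠ 0) (hY2 : Y + 1 ≠ 0) :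
    semiInvariant M (linearCoord M X Y * X) (linearCoord M X Y) = (Y - 1) / (Y + 1) := by
  have ht : linearCoord M X Y ≠ 0 := by
    unfold linearCoord
    positivity
  have : semiInvariant M (linearCoord M X Y * X) (linearCoord M X Y) =
      linearCoord M X Y * (X ^ (2 * M + 1) - 1) / X ^ M := by
    rw [semiInvariant]
    generalize linearCoord M X Y = t at *
    rw [div_eq_div_iff (by positivity) (by positivity)]
    ring
  rw [this, linearCoord]
  field_simp

/-- Y = (1+S)/(1-S) inverts the Cayley transform S = (Y-1)/(Y+1), after which the degree 1 equation
returns the scale b. -/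
theorem linearCoord_semiInvariant [CharZero k] (M : ℕ) {a b : k} (ha : a ≠ 0) (hb : b ≠ 0)
    (hab : a ^ (2 * M + 1) - b ^ (2 * M + 1) ≠ 0) (h1 : 1 - semiInvariant M a b ≠ 0) :
    linearCoord M (a / b) ((1 + semiInvariant M a b) / (1 - semiInvariant M a b)) = b := by
  have h2 : ((1 + semiInvariant M a b) / (1 - semiInvariant M a b) - 1) /
      ((1 + semiInvariant M a b) / (1 - semiInvariant M a b) + 1) = semiInvariant M a b := by
    rw [div_sub_one h1, div_add_one h1, div_div_div_cancel_right₀ h1]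
    rw [show 1 + semiInvariant M a b - (1 - semiInvariant M a b) = 2 * semiInvariant M a b by ring,
      show 1 + semiInvariant M a b + (1 - semiInvariant M a b) = 2 by ring,
      mul_div_cancel_left₀ _ two_ne_zero]
  rw [linearCoord, h2, semiInvariant]
  have h3 : (a / b) ^ (2 * M + 1) - 1 = (a ^ (2 * M + 1) - b ^ (2 * M + 1)) / b ^ (2 * M + 1) := by
    rw [div_pow, sub_div, div_self (pow_ne_zero _ hb)]
  rw [h3, div_pow, mul_pow]
  field_simp
  ring


/-- The Zariski open subset of `ℙ¹ × ℙ¹` on which `linearization` is an isomorphism. -/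
def linearizationSource (γ₁ γ₂ : GL (Fin 2) k) (p q r s : ℤ) (M : ℕ) : Set (Quadric k) :=
  quadricTorus γ₁ γ₂ ∩ {z | quadricMonomial γ₁ γ₂ p q z ^ (2 * M + 1) - 1 ≠ 0} ∩
    {z | quadricMonomial γ₁ γ₂ r s z - 1 ≠ 0} ∩ {z | quadricMonomial γ₁ γ₂ r s z + 1 ≠ 0}

/-- The image of `linearization`. -/
def linearizationTarget (k : Type*) [Field k] (M : ℕ) : Set (Plane k) :=
  Plane.torus k ∩ {z | z.affFst ^ (2 * M + 1) - z.affSnd ^ (2 * M + 1) ≠ 0} ∩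
    {z | 1 - semiInvariant M z.affFst z.affSnd ≠ 0} ∩
    {z | 1 + semiInvariant M z.affFst z.affSnd ≠ 0}

theorem affFst_ne_zero {z : Plane k} (hz : z ∈ Plane.torus k) : z.affFst ≠ 0 :=
  div_ne_zero hz.1 hz.2.2

theorem affSnd_ne_zero {z : Plane k} (hz : z ∈ Plane.torus k) : z.affSnd ≠ 0 :=
  div_ne_zero hz.2.1 hz.2.2

/-- The map from `ℙ¹ × ℙ¹` to the plane, in terms of the toric coordinates `x ^ p * y ^ q` and
`x ^ r * y ^ s`. -/
noncomputable def linearizationFun (γ₁ γ₂ : GL (Fin 2) k) (p q r s : ℤ) (M : ℕ) (z : Quadric k) :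
    Plane k :=
  Plane.ofAff
    (linearCoord M (quadricMonomial γ₁ γ₂ p q z) (quadricMonomial γ₁ γ₂ r s z) *
      quadricMonomial γ₁ γ₂ p q z)
    (linearCoord M (quadricMonomial γ₁ γ₂ p q z) (quadricMonomial γ₁ γ₂ r s z))

/-- The toric coordinate `x ^ r * y ^ s` as a function on the plane. -/
noncomputable def planeSndCoord (M : ℕ) (z : Plane k) : k :=
  (1 + semiInvariant M z.affFst z.affSnd) / (1 - semiInvariant M z.affFst z.affSnd)

/-- The inverse of `linearizationFun`. -/
noncomputable def linearizationInv (γ₁ γ₂ : GL (Fin 2) k) (p q r s : ℤ) (M : ℕ) (z : Plane k) :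
    Quadric k :=
  (coordPoint γ₁ ((z.affFst / z.affSnd) ^ s * planeSndCoord M z ^ (-q)),
    coordPoint γ₂ ((z.affFst / z.affSnd) ^ (-r) * planeSndCoord M z ^ p))

theorem planeSndCoord_ne_zero {M : ℕ} {z : Plane k} (hz : z ∈ linearizationTarget k M) :
    planeSndCoord M z ≠ 0 :=
  div_ne_zero hz.2 hz.1.2

theorem linearCoord_ne_zero {M : ℕ} {X Y : k} (hX : X ≠ 0) (hX1 : X ^ (2 * M + 1) - 1 ≠ 0)
    (hY1 : Y - 1 ≠ 0) (hY2 : Y + 1 ≠ 0) : linearCoord M X Y ≠ 0 := by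
  unfold linearCoord
  positivity

theorem linearizationFun_mem [CharZero k] {γ₁ γ₂ : GL (Fin 2) k} {p q r s : ℤ} {M : ℕ}
    {z : Quadric k} (hz : z ∈ linearizationSource γ₁ γ₂ p q r s M) :
    linearizationFun γ₁ γ₂ p q r s M z ∈ linearizationTarget k M := by
  obtain ⟨⟨⟨h0, h1⟩, h2⟩, h3⟩ := hz
  have hX := quadricMonomial_ne_zero h0 p q
  have hY := quadricMonomial_ne_zero h0 r s
  simp only [Set.mem_ofPred_eq] at h1 h2 h3
  rw [linearizationFun]
  generalize quadricMonomial γ₁ γ₂ p q z = X at *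
  generalize quadricMonomial γ₁ γ₂ r s z = Y at *
  have ht := linearCoord_ne_zero hX h1 h2 h3
  simp only [linearizationTarget, Set.mem_inter_iff, Set.mem_ofPred_eq, Plane.affFst_ofAff,
    Plane.affSnd_ofAff, semiInvariant_linearCoord M hX h1 h2 h3]
  refine ⟨⟨⟨Plane.ofAff_mem_torus (mul_ne_zero ht hX) ht, ?_⟩, ?_⟩, ?_⟩
  · rw [mul_pow, ← mul_sub_one]
    exact mul_ne_zero (pow_ne_zero _ ht) h1
  · rw [one_sub_div h3, show Y + 1 - (Y - 1) = 2 by ring]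
    exact div_ne_zero two_ne_zero h3
  · intro h
    rw [one_add_div h3, show Y + 1 + (Y - 1) = 2 * Y by ring, div_eq_zero_iff] at h
    exact hY (by simpa [h3] using h)

end MonomialCoordinates

/-! ### Birationality of the linearizing map. -/

section Linearization

variable {k : Type*} [Field k]

/-- The exponents s, -q, -r, p form the inverse matrix, so `monomial_inverse` applies with the two
matrices exchanged. -/
theorem quadricMonomial_linearizationInv {γ₁ γ₂ : GL (Fin 2) k} {p q r s : ℤ}
    (h : p * s - q * r = 1) {M : ℕ} {z : Plane k} (hz : z ∈ linearizationTarget k M) :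
    quadricMonomial γ₁ γ₂ p q (linearizationInv γ₁ γ₂ p q r s M z) = z.affFst / z.affSnd ∧
      quadricMonomial γ₁ γ₂ r s (linearizationInv γ₁ γ₂ p q r s M z) = planeSndCoord M z := by
  have := monomial_inverse (div_ne_zero (affFst_ne_zero hz.1.1.1) (affSnd_ne_zero hz.1.1.1))
    (planeSndCoord_ne_zero hz) (p := s) (q := -q) (r := -r) (s := p) (by linarith)
  simpa only [quadricMonomial, linearizationInv, coordRatio_coordPoint, neg_neg] using this

theorem linearizationInv_mem_quadricTorus (γ₁ γ₂ : GL (Fin 2) k) (p q r s : ℤ) {M : ℕ}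
    {z : Plane k} (hz : z ∈ linearizationTarget k M) :
    linearizationInv γ₁ γ₂ p q r s M z ∈ quadricTorus γ₁ γ₂ := by
  have h1 := div_ne_zero (affFst_ne_zero hz.1.1.1) (affSnd_ne_zero hz.1.1.1)
  have h2 := planeSndCoord_ne_zero hz
  exact ⟨coordPoint_mem_coordTorus _ (mul_ne_zero (zpow_ne_zero _ h1) (zpow_ne_zero _ h2)),
    coordPoint_mem_coordTorus _ (mul_ne_zero (zpow_ne_zero _ h1) (zpow_ne_zero _ h2))⟩

theorem linearizationInv_mem [CharZero k] {γ₁ γ₂ : GL (Fin 2) k} {p q r s : ℤ}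
    (h : p * s - q * r = 1) {M : ℕ} {z : Plane k} (hz : z ∈ linearizationTarget k M) :
    linearizationInv γ₁ γ₂ p q r s M z ∈ linearizationSource γ₁ γ₂ p q r s M := by
  obtain ⟨h1, h2⟩ := quadricMonomial_linearizationInv (γ₁ := γ₁) (γ₂ := γ₂) h hz
  have h3 := linearizationInv_mem_quadricTorus γ₁ γ₂ p q r s hz
  obtain ⟨⟨⟨h4, h5⟩, h6⟩, h7⟩ := hz
  have ha := affFst_ne_zero h4
  have hb := affSnd_ne_zero h4
  simp only [Set.mem_ofPred_eq] at h5 h6 h7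
  refine ⟨⟨⟨h3, ?_⟩, ?_⟩, ?_⟩
  · rw [Set.mem_ofPred_eq, h1, div_pow, div_sub_one (pow_ne_zero _ hb)]
    exact div_ne_zero h5 (pow_ne_zero _ hb)
  -- Y - 1 = 2S/(1-S) and, in the next case, Y + 1 = 2/(1-S); both are nonzero because 2 ≠ 0 and S ≠
  -- 0.
  · rw [Set.mem_ofPred_eq, h2, planeSndCoord, div_sub_one h6]
    refine div_ne_zero ?_ h6
    rw [add_sub_sub_cancel, ← two_mul]
    exact mul_ne_zero two_ne_zero (div_ne_zero h5 (pow_ne_zero _ (mul_ne_zero ha hb)))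
  · rw [Set.mem_ofPred_eq, h2, planeSndCoord, div_add_one h6]
    refine div_ne_zero ?_ h6
    rw [add_add_sub_cancel, one_add_one_eq_two]
    exact two_ne_zero

theorem linearizationInv_linearizationFun [CharZero k] {γ₁ γ₂ : GL (Fin 2) k} {p q r s : ℤ}
    (h : p * s - q * r = 1) {M : ℕ} {z : Quadric k}
    (hz : z ∈ linearizationSource γ₁ γ₂ p q r s M) :
    linearizationInv γ₁ γ₂ p q r s M (linearizationFun γ₁ γ₂ p q r s M z) = z := by
  obtain ⟨⟨⟨h0, h1⟩, h2⟩, h3⟩ := hz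
  have hX := quadricMonomial_ne_zero h0 p q
  have hY := quadricMonomial_ne_zero h0 r s
  simp only [Set.mem_ofPred_eq] at h1 h2 h3
  have ht := linearCoord_ne_zero hX h1 h2 h3
  have hS := semiInvariant_linearCoord M hX h1 h2 h3
  have hY' : planeSndCoord M (linearizationFun γ₁ γ₂ p q r s M z) =
      quadricMonomial γ₁ γ₂ r s z := by
    simp only [planeSndCoord, linearizationFun, Plane.affFst_ofAff, Plane.affSnd_ofAff, hS]
    rw [one_add_div h3, one_sub_div h3, div_div_div_cancel_right₀ h3]
    rw [add_sub_sub_cancel, one_add_one_eq_two, show ∀ y : k, y + 1 + (y - 1) = 2 * y by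
      intro y; ring]
    exact mul_div_cancel_left₀ _ two_ne_zero
  have hX' : (linearizationFun γ₁ γ₂ p q r s M z).affFst /
      (linearizationFun γ₁ γ₂ p q r s M z).affSnd = quadricMonomial γ₁ γ₂ p q z := by
    simp only [linearizationFun, Plane.affFst_ofAff, Plane.affSnd_ofAff]
    exact mul_div_cancel_left₀ _ ht
  obtain ⟨h4, h5⟩ := monomial_inverse (coordRatio_ne_zero h0.1) (coordRatio_ne_zero h0.2) h
  simp only [linearizationInv, hX', hY', quadricMonomial, h4, h5, coordPoint_coordRatio h0.1,
    coordPoint_coordRatio h0.2]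

theorem linearizationFun_linearizationInv [CharZero k] {γ₁ γ₂ : GL (Fin 2) k} {p q r s : ℤ}
    (h : p * s - q * r = 1) {M : ℕ} {z : Plane k} (hz : z ∈ linearizationTarget k M) :
    linearizationFun γ₁ γ₂ p q r s M (linearizationInv γ₁ γ₂ p q r s M z) = z := by
  obtain ⟨h1, h2⟩ := quadricMonomial_linearizationInv (γ₁ := γ₁) (γ₂ := γ₂) h hz
  have ha := affFst_ne_zero hz.1.1.1
  have hb := affSnd_ne_zero hz.1.1.1
  rw [linearizationFun, h1, h2, planeSndCoord, linearCoord_semiInvariant M ha hb hz.1.1.2 hz.1.2,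
    mul_div_cancel₀ _ hb, Plane.ofAff_aff hz.1.1.1]

/-- The birational map from `ℙ¹ × ℙ¹` to the plane which linearizes dihedral groups acting by
monomial transformations. -/
noncomputable def linearization [CharZero k] (γ₁ γ₂ : GL (Fin 2) k) (p q r s : ℤ)
    (h : p * s - q * r = 1) (M : ℕ) : PartialEquiv (Quadric k) (Plane k) where
  toFun := linearizationFun γ₁ γ₂ p q r s M
  invFun := linearizationInv γ₁ γ₂ p q r s M
  source := linearizationSource γ₁ γ₂ p q r s M
  target := linearizationTarget k M
  map_source' _ hz := linearizationFun_mem hz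
  map_target' _ hz := linearizationInv_mem h hz
  left_inv' _ hz := linearizationInv_linearizationFun h hz
  right_inv' _ hz := linearizationFun_linearizationInv h hz

theorem linearizationSource_nonempty [CharZero k] (γ₁ γ₂ : GL (Fin 2) k) {p q r s : ℤ}
    (h : p * s - q * r = 1) (M : ℕ) : (linearizationSource γ₁ γ₂ p q r s M).Nonempty := by
  have h2 : (2 : k) ≠ 0 := two_ne_zero
  obtain ⟨h3, h4⟩ := monomial_inverse h2 h2 (p := s) (q := -q) (r := -r) (s := p) (by linarith)
  have hx : (2 : k) ^ s * 2 ^ (-q) ≠ 0 := mul_ne_zero (zpow_ne_zero _ h2) (zpow_ne_zero _ h2)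
  have hy : (2 : k) ^ (-r) * 2 ^ p ≠ 0 := mul_ne_zero (zpow_ne_zero _ h2) (zpow_ne_zero _ h2)
  have hX : quadricMonomial γ₁ γ₂ p q
      (coordPoint γ₁ (2 ^ s * 2 ^ (-q)), coordPoint γ₂ (2 ^ (-r) * 2 ^ p)) = 2 := by
    simpa only [quadricMonomial, coordRatio_coordPoint, neg_neg] using h3
  have hY : quadricMonomial γ₁ γ₂ r s
      (coordPoint γ₁ (2 ^ s * 2 ^ (-q)), coordPoint γ₂ (2 ^ (-r) * 2 ^ p)) = 2 := by
    simpa only [quadricMonomial, coordRatio_coordPoint, neg_neg] using h4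
  -- The point with X = Y = 2: in characteristic zero 2 is neither ±1 nor a root of unity.
  refine ⟨(coordPoint γ₁ (2 ^ s * 2 ^ (-q)), coordPoint γ₂ (2 ^ (-r) * 2 ^ p)),
    ⟨⟨⟨coordPoint_mem_coordTorus _ hx, coordPoint_mem_coordTorus _ hy⟩, ?_⟩, ?_⟩, ?_⟩
  · rw [Set.mem_ofPred_eq, hX, sub_ne_zero]
    exact_mod_cast (Nat.one_lt_two_pow (by omega : 2 * M + 1 ≠ 0)).ne'
  · rw [Set.mem_ofPred_eq, hY]
    norm_num
  · rw [Set.mem_ofPred_eq, hY]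
    norm_num

theorem isPrincipalOpen_linearizationSource (γ₁ γ₂ : GL (Fin 2) k) (p q r s : ℤ) (M : ℕ) :
    IsPrincipalOpen Quadric.coord Quadric.degree (linearizationSource γ₁ γ₂ p q r s M) := by
  have hX := isRatioOn_quadricMonomial γ₁ γ₂ p q
  have hY := isRatioOn_quadricMonomial γ₁ γ₂ r s
  refine (((isPrincipalOpen_quadricTorus γ₁ γ₂).inter_ne_zero ?_).inter_ne_zero ?_).inter_ne_zero ?_
  · exact (hX.pow _).sub (.const 1)
  · exact (hY.sub (.const 1)).mono Set.inter_subset_left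
  · exact (hY.add (.const 1)).mono (Set.inter_subset_left.trans Set.inter_subset_left)

theorem isRatioOn_semiInvariant (M : ℕ) :
    IsRatioOn Plane.coord Plane.degree (Plane.torus k)
      fun z => semiInvariant M z.affFst z.affSnd :=
  ((isRatioOn_affFst.pow _).sub (isRatioOn_affSnd.pow _)).div
    ((isRatioOn_affFst.mul isRatioOn_affSnd).pow _)
    fun _ hz => pow_ne_zero _ (mul_ne_zero (affFst_ne_zero hz) (affSnd_ne_zero hz))

theorem isPrincipalOpen_linearizationTarget (k : Type*) [Field k] (M : ℕ) :
    IsPrincipalOpen Plane.coord Plane.degree (linearizationTarget k M) := by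
  refine ((isPrincipalOpen_planeTorus.inter_ne_zero ?_).inter_ne_zero ?_).inter_ne_zero ?_
  · exact (isRatioOn_affFst.pow _).sub (isRatioOn_affSnd.pow _)
  · exact ((IsRatioOn.const 1).sub (isRatioOn_semiInvariant M)).mono Set.inter_subset_left
  · exact ((IsRatioOn.const 1).add (isRatioOn_semiInvariant M)).mono
      (Set.inter_subset_left.trans Set.inter_subset_left)

theorem isBirational_linearization [CharZero k] (γ₁ γ₂ : GL (Fin 2) k) {p q r s : ℤ}
    (h : p * s - q * r = 1) (M : ℕ) : IsBirational (linearization γ₁ γ₂ p q r s h M) := by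
  have hU : linearizationSource γ₁ γ₂ p q r s M ⊆ quadricTorus γ₁ γ₂ := fun _ hz => hz.1.1.1
  have hV : linearizationTarget k M ⊆ Plane.torus k := fun _ hz => hz.1.1.1
  have hX := (isRatioOn_quadricMonomial γ₁ γ₂ p q).mono hU
  have hY := (isRatioOn_quadricMonomial γ₁ γ₂ r s).mono hU
  have ht : IsRatioOn Quadric.coord Quadric.degree (linearizationSource γ₁ γ₂ p q r s M)
      fun z => linearCoord M (quadricMonomial γ₁ γ₂ p q z) (quadricMonomial γ₁ γ₂ r s z) :=
    (((hY.sub (.const 1)).div (hY.add (.const 1)) fun _ hz => hz.2).mul (hX.pow _)).div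
      ((hX.pow _).sub (.const 1)) fun _ hz => hz.1.1.2
  have ha := (isRatioOn_affFst (k := k)).mono hV
  have hb := (isRatioOn_affSnd (k := k)).mono hV
  have hS := (isRatioOn_semiInvariant (k := k) M).mono hV
  have hXV := (ha.div hb fun _ hz => affSnd_ne_zero hz.1.1.1).zpow fun _ hz =>
    div_ne_zero (affFst_ne_zero hz.1.1.1) (affSnd_ne_zero hz.1.1.1)
  have hYV : ∀ n : ℤ, IsRatioOn Plane.coord Plane.degree (linearizationTarget k M)
      fun z => planeSndCoord M z ^ n := fun n =>
    IsRatioOn.zpow (((IsRatioOn.const 1).add hS).div ((IsRatioOn.const 1).sub hS) fun _ hz => hz.1.2)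
      (fun _ hz => planeSndCoord_ne_zero hz) n
  exact
    { source_nonempty := linearizationSource_nonempty γ₁ γ₂ h M
      source_open := (isPrincipalOpen_linearizationSource γ₁ γ₂ p q r s M).isZariskiOpen
      target_open := (isPrincipalOpen_linearizationTarget k M).isZariskiOpen
      regular := (ht.mul hX).isRegularMapOn_ofAff ht
      regular_symm_fst := ((hXV s).mul (hYV (-q))).isRegularMapOn_coordPoint γ₁
      regular_symm_snd := ((hXV (-r)).mul (hYV p)).isRegularMapOn_coordPoint γ₂ }

end Linearization

/-! ### Normal form of dihedral actions on ℙ¹. -/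

section NormalForm

open Matrix

variable {k : Type*} [Field k]

/-- If e₁, e₂ and e₁ + e₂ are all eigenvectors, the matrix is scalar. -/
theorem exists_mulVec_ne_smul {B : Matrix (Fin 2) (Fin 2) k} (hB : ∀ b : k, B ≠ b • 1) :
    ∃ v, ∀ b : k, B *ᵥ v ≠ b • v := by
  by_contra! H
  obtain ⟨b₀, h₀⟩ := H ![1, 0]
  obtain ⟨b₁, h₁⟩ := H ![0, 1]
  obtain ⟨b₂, h₂⟩ := H ![1, 1]
  have h₀0 := congrFun h₀ 0
  have h₀1 := congrFun h₀ 1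
  have h₁0 := congrFun h₁ 0
  have h₁1 := congrFun h₁ 1
  have h₂0 := congrFun h₂ 0
  have h₂1 := congrFun h₂ 1
  simp at h₀0 h₀1 h₁0 h₁1 h₂0 h₂1
  apply hB (B 0 0)
  ext i j
  fin_cases i <;> fin_cases j <;> simp [h₀1, h₁0]
  grind

/-- By Cayley–Hamilton, tr(B)·B is scalar when B² is, so a nonscalar B has trace zero. The proof
checks this on entries. -/
theorem trace_eq_zero_of_mul_self_eq_smul_one {B : Matrix (Fin 2) (Fin 2) k} {c : k}
    (h : B * B = c • 1) (hB : ∀ b : k, B ≠ b • 1) : B 1 1 = -B 0 0 := by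
  by_contra hne
  have h01 := congrFun (congrFun h 0) 1
  have h10 := congrFun (congrFun h 1) 0
  have h00 := congrFun (congrFun h 0) 0
  have h11 := congrFun (congrFun h 1) 1
  simp [mul_apply] at h01 h10 h00 h11
  have hs : B 0 0 + B 1 1 ≠ 0 := fun h => hne (by linear_combination h)
  have h1 : B 0 1 = 0 := by
    refine (mul_eq_zero.1 (?_ : B 0 1 * (B 0 0 + B 1 1) = 0)).resolve_right hs
    linear_combination h01
  have h2 : B 1 0 = 0 := by
    refine (mul_eq_zero.1 (?_ : B 1 0 * (B 0 0 + B 1 1) = 0)).resolve_right hs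
    linear_combination h10
  have h3 : B 0 0 - B 1 1 = 0 := by
    refine (mul_eq_zero.1 (?_ : (B 0 0 - B 1 1) * (B 0 0 + B 1 1) = 0)).resolve_right hs
    rw [h1, h2] at h00 h11
    linear_combination h00 - h11
  apply hB (B 0 0)
  ext i j
  fin_cases i <;> fin_cases j <;> simp [h1, h2]
  linear_combination -h3

/-- Since N² = 0, the power is tⁿ + n tⁿ⁻¹N with n tⁿ⁻¹ ≠ 0. So N is scalar, and a nilpotent scalar
vanishes. -/
theorem eq_zero_of_pow_smul_one_add_eq [CharZero k] {m : Type*} [Fintype m] [DecidableEq m]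
    {N : Matrix m m k} {t ν : k} (ht : t ≠ 0) (hN : N * N = 0) {n : ℕ} (hn : n ≠ 0)
    (h : (t • 1 + N) ^ n = ν • 1) : N = 0 := by
  have key : ∀ j : ℕ, (t • 1 + N) ^ (j + 1) = t ^ (j + 1) • 1 + ((j + 1) * t ^ j) • N := by
    intro j
    induction j with
    | zero => simp
    | succ j ih =>
      rw [pow_succ, ih, add_mul, mul_add, mul_add, smul_mul_smul_comm, smul_mul_smul_comm,
        smul_mul_assoc, smul_mul_assoc, hN, one_mul, one_mul, mul_one]
      push_cast
      module
  obtain ⟨j, rfl⟩ := Nat.exists_eq_succ_of_ne_zero hn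
  have hu : ((j + 1) * t ^ j : k) ≠ 0 := mul_ne_zero (by exact_mod_cast hn) (pow_ne_zero _ ht)
  have h1 : N = (((j + 1) * t ^ j)⁻¹ * (ν - t ^ (j + 1))) • (1 : Matrix m m k) := by
    rw [mul_smul, sub_smul, ← h, key j, add_sub_cancel_left, smul_smul, inv_mul_cancel₀ hu,
      one_smul]
  rw [h1, smul_mul_smul_comm, mul_one] at hN
  rw [h1]
  rcases smul_eq_zero.1 hN with h | h
  · rw [mul_self_eq_zero.1 h, zero_smul]
  · rw [h, smul_zero]

/-- If `A` and `B` induce on `ℙ¹` an element of odd order and an involution inverting it, then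
`A` has an eigenvector which is not an eigenvector of `B`. -/
theorem exists_eigenvector_not_eigenvector [IsAlgClosed k] [CharZero k]
    {A B : Matrix (Fin 2) (Fin 2) k} {n : ℕ} (hn : Odd n) {ν c μ : k} (hc : c ≠ 0) (hμ : μ ≠ 0)
    (hA : A ^ n = ν • 1) (hB : B * B = c • 1) (hBA : B * A * (B * A) = μ • 1)
    (hB' : ∀ b : k, B ≠ b • 1) :
    ∃ v, ∃ a : k, A *ᵥ v = a • v ∧ ∀ b : k, B *ᵥ v ≠ b • v := by
  by_cases hA' : ∃ a : k, A = a • 1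
  · obtain ⟨a, rfl⟩ := hA'
    obtain ⟨v, hv⟩ := exists_mulVec_ne_smul hB'
    exact ⟨v, a, by rw [smul_mulVec, one_mulVec], hv⟩
  push Not at hA'
  obtain ⟨a, ha⟩ := Module.End.exists_eigenvalue (toLin' A)
  obtain ⟨v, hv⟩ := ha.exists_hasEigenvector
  have hv0 := hv.2
  have hAv : A *ᵥ v = a • v := by simpa using hv.apply_eq_smul
  refine ⟨v, a, hAv, fun b hBv => ?_⟩
  have hcA : B * (B * A) = c • A := by rw [← mul_assoc, hB, smul_mul_assoc, one_mul]
  -- If BA were scalar, A would be proportional to B; an odd power of B is a multiple of B, so Aⁿ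
  -- scalar would force B scalar.
  have hC : ∀ e : k, B * A ≠ e • 1 := by
    intro e he
    have h1 : A = (c⁻¹ * e) • B := by
      rw [he, mul_smul_comm, mul_one] at hcA
      rw [mul_smul, hcA, smul_smul, inv_mul_cancel₀ hc, one_smul]
    have he0 : e ≠ 0 := by
      rintro rfl
      rw [mul_zero, zero_smul] at h1
      exact hA' 0 (by rw [h1, zero_smul])
    obtain ⟨j, rfl⟩ := hn
    have hBn : B ^ (2 * j + 1) = c ^ j • B := by
      rw [pow_succ, pow_mul, pow_two, hB, smul_pow, one_pow, smul_mul_assoc, one_mul]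
    rw [h1, smul_pow, hBn, smul_smul] at hA
    have hu : (c⁻¹ * e) ^ (2 * j + 1) * c ^ j ≠ 0 := by positivity
    refine hB' (((c⁻¹ * e) ^ (2 * j + 1) * c ^ j)⁻¹ * ν) ?_
    rw [mul_smul, ← hA, smul_smul, inv_mul_cancel₀ hu, one_smul]
  have hBt := trace_eq_zero_of_mul_self_eq_smul_one hB hB'
  have hCt := trace_eq_zero_of_mul_self_eq_smul_one hBA hC
  have hCv : (B * A) *ᵥ v = (a * b) • v := by
    rw [← mulVec_mulVec, hAv, mulVec_smul, hBv, smul_smul]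
  have inj : ∀ x y : k, x • v = y • v → x = y := fun x y h => smul_left_injective k hv0 h
  have hb : b * b = c := inj _ _ <| by
    rw [mul_smul, ← hBv, ← mulVec_smul, ← hBv, mulVec_mulVec, hB, smul_mulVec, one_mulVec]
  have he : a * b * (a * b) = μ := inj _ _ <| by
    rw [mul_smul, ← hCv, ← mulVec_smul, ← hCv, mulVec_mulVec, hBA, smul_mulVec, one_mulVec]
  generalize hCdef : B * A = C at *
  -- The anticommutator of two traceless 2×2 matrices is scalar; the common eigenvector v then gives
  -- its value.
  obtain ⟨τ, hτ⟩ : ∃ τ : k, B * C + C * B = τ • 1 := by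
    refine ⟨(B * C + C * B) 0 0, ?_⟩
    ext i j
    fin_cases i <;> fin_cases j <;> simp [mul_apply, hBt, hCt] <;> ring
  have hτ' : τ = 2 * (b * (a * b)) := inj _ _ <| by
    have := congrArg (· *ᵥ v) hτ
    simp only [add_mulVec, ← mulVec_mulVec, hCv, hBv, mulVec_smul, smul_mulVec, one_mulVec] at this
    rw [← this, smul_smul, smul_smul, ← add_smul]
    ring_nf
  -- cA = BC satisfies Z² - τZ + cμ = 0, which has the double root b(ab). Thus A is scalar plus
  -- nilpotent, and Aⁿ scalar kills the nilpotent part.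
  have hN : (c • A - (b * (a * b)) • 1) * (c • A - (b * (a * b)) • 1) = 0 := by
    have h1 : B * C * (B * C) = τ • (B * C) - (c * μ) • 1 := by
      have : B * C * (C * B) = (c * μ) • 1 := by
        rw [mul_assoc, ← mul_assoc C, hBA, smul_mul_assoc, one_mul, mul_smul_comm, hB, smul_smul,
          mul_comm]
      rw [← this, eq_sub_iff_add_eq, ← mul_add, hτ, mul_smul_comm, mul_one]
    rw [← hcA, sub_mul, mul_sub, mul_sub, h1, smul_mul_smul_comm, smul_mul_assoc, one_mul,
      mul_smul_comm, mul_one, mul_one, hτ', ← hb, ← he]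
    module
  have h2 : c • A - (b * (a * b)) • 1 = 0 := by
    refine eq_zero_of_pow_smul_one_add_eq (t := b * (a * b)) (ν := c ^ n * ν) (n := n) ?_ hN
      hn.pos.ne' ?_
    · rintro h
      have : (b * b) * (a * b * (a * b)) = 0 := by linear_combination (b * (a * b)) * h
      rw [hb, he] at this
      exact mul_ne_zero hc hμ this
    · rw [add_sub_cancel, smul_pow, hA, smul_smul]
  apply hA' (c⁻¹ * (b * (a * b)))
  rw [mul_smul, ← sub_eq_zero.1 h2, smul_smul, inv_mul_cancel₀ hc, one_smul]

/-- In the affine coordinate given by `γ`, the transformation `g` is `x ↦ a * x ^ ε`. -/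
def ActsAs (γ : GL (Fin 2) k) (g : PGL(2, k)) (a : k) (ε : ℤ) : Prop :=
  ∀ p ∈ coordTorus γ, g • p ∈ coordTorus γ ∧ coordRatio γ (g • p) = a * coordRatio γ p ^ ε

theorem ActsAs.mul {γ : GL (Fin 2) k} {g g' : PGL(2, k)} {a a' : k} {ε ε' : ℤ}
    (h : ActsAs γ g a ε) (h' : ActsAs γ g' a' ε') : ActsAs γ (g * g') (a * a' ^ ε) (ε' * ε) := by
  intro p hp
  obtain ⟨h1, h2⟩ := h' p hp
  obtain ⟨h3, h4⟩ := h _ h1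
  rw [mul_smul]
  exact ⟨h3, by rw [h4, h2, mul_zpow, ← _root_.zpow_mul, mul_assoc]⟩

theorem ActsAs.one (γ : GL (Fin 2) k) : ActsAs γ 1 1 1 := fun p hp => by simpa using hp

theorem ActsAs.pow {γ : GL (Fin 2) k} {g : PGL(2, k)} {a : k} (h : ActsAs γ g a 1) (n : ℕ) :
    ActsAs γ (g ^ n) (a ^ n) 1 := by
  induction n with
  | zero => simpa using ActsAs.one γ
  | succ n ih => simpa [pow_succ] using ih.mul h

theorem actsAs_of_diagonal {γ A : GL (Fin 2) k} {a d : k} (ha : a ≠ 0) (hd : d ≠ 0)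
    (h : γ.1 * A.1 = !![a, 0; 0, d] * γ.1) : ActsAs γ (ProjGenLinGroup.mk A) (a / d) 1 := by
  intro p hp
  induction p with | h v hv
  have h1 : γ.1 *ᵥ (A • v) = ![a * (γ.1 *ᵥ v) 0, d * (γ.1 *ᵥ v) 1] := by
    rw [Units.smul_def, Matrix.smul_eq_mulVec, mulVec_mulVec, h, ← mulVec_mulVec]
    ext i
    generalize γ.1 *ᵥ v = u
    fin_cases i <;> simp [vecHead, vecTail]
  rw [mk_mem_coordTorus] at hp
  rw [Projectivization.PGL.mk_smul_mk, mk_mem_coordTorus, coordRatio_mk, coordRatio_mk, h1]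
  refine ⟨⟨mul_ne_zero ha hp.1, mul_ne_zero hd hp.2⟩, ?_⟩
  rw [zpow_one, div_mul_div_comm]
  rfl

theorem actsAs_of_antidiagonal {γ A : GL (Fin 2) k} {a d : k} (ha : a ≠ 0) (hd : d ≠ 0)
    (h : γ.1 * A.1 = !![0, a; d, 0] * γ.1) : ActsAs γ (ProjGenLinGroup.mk A) (a / d) (-1) := by
  intro p hp
  induction p with | h v hv
  have h1 : γ.1 *ᵥ (A • v) = ![a * (γ.1 *ᵥ v) 1, d * (γ.1 *ᵥ v) 0] := by
    rw [Units.smul_def, Matrix.smul_eq_mulVec, mulVec_mulVec, h, ← mulVec_mulVec]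
    ext i
    generalize γ.1 *ᵥ v = u
    fin_cases i <;> simp [vecHead, vecTail]
  rw [mk_mem_coordTorus] at hp
  rw [Projectivization.PGL.mk_smul_mk, mk_mem_coordTorus, coordRatio_mk, coordRatio_mk, h1]
  refine ⟨⟨mul_ne_zero ha hp.2, mul_ne_zero hd hp.1⟩, ?_⟩
  rw [_root_.zpow_neg_one, inv_div, div_mul_div_comm]
  rfl

theorem exists_smul_one_of_mk_eq_one {A : GL (Fin 2) k} (h : ProjGenLinGroup.mk A = 1) :
    ∃ a : k, a ≠ 0 ∧ A.1 = a • 1 := by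
  rw [← map_one ProjGenLinGroup.mk, eq_comm, ProjGenLinGroup.mk_eq_mk_iff] at h
  obtain ⟨u, rfl⟩ := h
  refine ⟨u, u.ne_zero, ?_⟩
  simp [smul_one_eq_diagonal]

theorem mk_eq_one_of_eq_smul_one {A : GL (Fin 2) k} {a : k} (h : A.1 = a • 1) :
    ProjGenLinGroup.mk A = 1 := by
  rw [ProjGenLinGroup.mk_eq_one, GeneralLinearGroup.mem_center_iff_val_mem_range_scalar]
  exact ⟨a, by rw [h, scalar_apply, smul_one_eq_diagonal]⟩

/-- An element of odd order of `PGL₂` and an involution inverting it are `x ↦ ζ * x` and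
`x ↦ x⁻¹` in a suitable coordinate. -/
theorem exists_actsAs_dihedral [IsAlgClosed k] [CharZero k] {R S : PGL(2, k)} {n : ℕ}
    (hn : Odd n) (hR : R ^ n = 1) (hS : S * S = 1) (hS1 : S ≠ 1) (hSR : S * R * (S * R) = 1) :
    ∃ (γ : GL (Fin 2) k) (ζ : k), ζ ^ n = 1 ∧ ActsAs γ R ζ 1 ∧ ActsAs γ S 1 (-1) := by
  obtain ⟨A, rfl⟩ := ProjGenLinGroup.mk_surjective R
  obtain ⟨B, rfl⟩ := ProjGenLinGroup.mk_surjective S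
  simp only [← map_mul, ← map_pow] at hR hS hSR
  obtain ⟨ν, hν, hA⟩ := exists_smul_one_of_mk_eq_one hR
  obtain ⟨c, hc, hB⟩ := exists_smul_one_of_mk_eq_one hS
  obtain ⟨μ, hμ, hBA⟩ := exists_smul_one_of_mk_eq_one hSR
  have hB' : ∀ b : k, B.1 ≠ b • 1 := fun b hb => hS1 (mk_eq_one_of_eq_smul_one hb)
  simp only [Units.val_mul, Units.val_pow_eq_pow_val] at hA hB hBA
  obtain ⟨v, a, hAv, hBv⟩ := exists_eigenvector_not_eigenvector hn hc hμ hA hB hBA hB'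
  have hv0 : v ≠ 0 := by
    rintro rfl
    exact hBv 0 (by simp)
  have ha : a ≠ 0 := by
    rintro rfl
    exact gl_mulVec_ne_zero A hv0 (by rw [hAv, zero_smul])
  have hBBv : B.1 *ᵥ (B.1 *ᵥ v) = c • v := by
    rw [mulVec_mulVec, hB, smul_mulVec, one_mulVec]
  -- Apply B to BABAv = μv: the vector Bv is again an eigenvector of A.
  have hABv : A.1 *ᵥ (B.1 *ᵥ v) = (μ / (a * c)) • (B.1 *ᵥ v) := by
    have h1 := congrArg (fun Z => B.1 *ᵥ (Z *ᵥ v)) hBA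
    simp only [← mulVec_mulVec, hAv, mulVec_smul, smul_mulVec, one_mulVec] at h1
    rw [mulVec_mulVec _ B.1 B.1, hB, smul_mulVec, one_mulVec, smul_smul] at h1
    rw [div_eq_inv_mul, mul_smul, ← h1, smul_smul, inv_mul_cancel₀ (mul_ne_zero ha hc), one_smul]
  set d := μ / (a * c) with hd
  have hd0 : d ≠ 0 := div_ne_zero hμ (mul_ne_zero ha hc)
  -- With e² = c and u = e⁻¹Bv, B exchanges v and u with the same factor e, so it acts as exactly x
  -- ↦ 1/x.
  obtain ⟨e, he⟩ := IsAlgClosed.exists_pow_nat_eq c (n := 2) (by norm_num)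
  have he0 : e ≠ 0 := by
    rintro rfl
    exact hc (by simpa using he.symm)
  have pow_eigen : ∀ (u : Fin 2 → k) (t : k), A.1 *ᵥ u = t • u → u ≠ 0 → t ^ n = ν := by
    intro u t hu hu0
    have : ∀ j : ℕ, (A.1 ^ j) *ᵥ u = t ^ j • u := by
      intro j
      induction j with
      | zero => simp
      | succ j ih => rw [pow_succ, ← mulVec_mulVec, hu, mulVec_smul, ih, smul_smul, pow_succ']
    have h := this n
    rw [hA, smul_mulVec, one_mulVec] at h
    exact (smul_left_injective k hu0 h).symm
  have han := pow_eigen v a hAv hv0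
  have hdn := pow_eigen _ d hABv (gl_mulVec_ne_zero B hv0)
  set u := e⁻¹ • (B.1 *ᵥ v) with hu
  have hdet : v 0 * u 1 - u 0 * v 1 ≠ 0 := by
    intro h
    have h' : v 0 * (B.1 *ᵥ v) 1 - (B.1 *ᵥ v) 0 * v 1 = 0 := by
      simp only [hu, Pi.smul_apply, smul_eq_mul] at h
      have := congrArg (e * ·) h
      field_simp at this
      simpa using this
    by_cases h0 : v 0 = 0
    · have h1 : v 1 ≠ 0 := fun h1 => hv0 (by ext i; fin_cases i <;> simp [h0, h1])
      apply hBv ((B.1 *ᵥ v) 1 / v 1)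
      rw [h0, zero_mul, zero_sub, neg_eq_zero] at h'
      have h2 := (mul_eq_zero.1 h').resolve_right h1
      ext i
      fin_cases i
      · change (B.1 *ᵥ v) 0 = _ * v 0
        rw [h2, h0, mul_zero]
      · exact (div_mul_cancel₀ _ h1).symm
    · apply hBv ((B.1 *ᵥ v) 0 / v 0)
      ext i
      fin_cases i
      · exact (div_mul_cancel₀ _ h0).symm
      · change (B.1 *ᵥ v) 1 = (B.1 *ᵥ v) 0 / v 0 * v 1
        field_simp
        linear_combination h'
  let P : GL (Fin 2) k := GeneralLinearGroup.mkOfDetNeZero !![v 0, u 0; v 1, u 1] (by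
    rwa [det_fin_two_of])
  have hBu : B.1 *ᵥ u = e • v := by
    rw [hu, mulVec_smul, hBBv, smul_smul, ← he, pow_two, inv_mul_cancel_left₀ he0]
  have hBv' : B.1 *ᵥ v = e • u := by
    rw [hu, smul_smul, mul_inv_cancel₀ he0, one_smul]
  have hAu : A.1 *ᵥ u = d • u := by
    rw [hu, mulVec_smul, hABv, smul_comm]
  have conj : ∀ C D : Matrix (Fin 2) (Fin 2) k, C * P.1 = P.1 * D → P⁻¹.1 * C = D * P⁻¹.1 := by
    intro C D h
    calc P⁻¹.1 * C = P⁻¹.1 * (C * P.1) * P⁻¹.1 := by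
          rw [mul_assoc, mul_assoc, ← Units.val_mul, mul_inv_cancel, Units.val_one, mul_one]
      _ = D * P⁻¹.1 := by
          rw [h, ← mul_assoc, ← Units.val_mul, inv_mul_cancel, Units.val_one, one_mul]
  refine ⟨P⁻¹, a / d, ?_, actsAs_of_diagonal ha hd0 (conj _ _ ?_), ?_⟩
  · rw [div_pow, han, hdn, div_self hν]
  · have e0 := congrFun hAv
    have e1 := congrFun hAu
    simp only [mulVec, dotProduct, Fin.sum_univ_two, Pi.smul_apply, smul_eq_mul] at e0 e1
    ext i j
    fin_cases j <;> fin_cases i <;> simp [P, mul_apply, GeneralLinearGroup.mkOfDetNeZero]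
    exacts [by linear_combination e0 0, by linear_combination e0 1, by linear_combination e1 0,
      by linear_combination e1 1]
  · have := actsAs_of_antidiagonal (γ := P⁻¹) (A := B) he0 he0 (conj _ _ ?_)
    · rwa [div_self he0] at this
    · have e0 := congrFun hBv'
      have e1 := congrFun hBu
      simp only [mulVec, dotProduct, Fin.sum_univ_two, Pi.smul_apply, smul_eq_mul] at e0 e1
      ext i j
      fin_cases j <;> fin_cases i <;> simp [P, mul_apply, GeneralLinearGroup.mkOfDetNeZero]
      exacts [by linear_combination e0 0, by linear_combination e0 1, by linear_combination e1 0,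
        by linear_combination e1 1]

end NormalForm

/-! ### Linearity of the action in the plane. -/

section PlaneAction

open Matrix

variable {k : Type*} [Field k]

theorem exists_smul_ofAff_eq_diagonal {c d : k} (hc : c ≠ 0) (hd : d ≠ 0) :
    ∃ A : PGL(3, k), ∀ a b : k, A • Plane.ofAff a b = Plane.ofAff (c * a) (d * b) := by
  refine ⟨ProjGenLinGroup.mk (GeneralLinearGroup.mkOfDetNeZero (diagonal ![c, d, 1]) ?_), ?_⟩
  · simp [det_diagonal, Fin.prod_univ_three, hc, hd]
  · intro a b
    rw [Plane.ofAff, Plane.ofAff, Projectivization.PGL.mk_smul_mk, Projectivization.mk_eq_mk_iff']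
    refine ⟨1, ?_⟩
    rw [one_smul, Units.smul_def, Matrix.smul_eq_mulVec]
    ext i
    fin_cases i <;> simp [GeneralLinearGroup.mkOfDetNeZero, mulVec_diagonal]

theorem exists_smul_ofAff_eq_swap {c d : k} (hc : c ≠ 0) (hd : d ≠ 0) :
    ∃ A : PGL(3, k), ∀ a b : k, A • Plane.ofAff a b = Plane.ofAff (c * b) (d * a) := by
  refine ⟨ProjGenLinGroup.mk
    (GeneralLinearGroup.mkOfDetNeZero !![0, c, 0; d, 0, 0; 0, 0, 1] ?_), ?_⟩
  · simp [det_fin_three, hc, hd]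
  · intro a b
    rw [Plane.ofAff, Plane.ofAff, Projectivization.PGL.mk_smul_mk, Projectivization.mk_eq_mk_iff']
    refine ⟨1, ?_⟩
    rw [one_smul, Units.smul_def, Matrix.smul_eq_mulVec]
    ext i
    fin_cases i <;> simp [GeneralLinearGroup.mkOfDetNeZero, vecHead, vecTail, mul_comm]

theorem linearCoord_mul_left (M : ℕ) {η : k} (hη : η ^ (2 * M + 1) = 1) (X Y : k) :
    linearCoord M (η * X) Y = η ^ M * linearCoord M X Y := by
  simp only [linearCoord, mul_pow, hη, one_mul]
  ring

theorem linearCoord_inv_left (M : ℕ) {X : k} (hX : X ≠ 0) (hX1 : X ^ (2 * M + 1) - 1 ≠ 0) (Y : k) :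
    linearCoord M X⁻¹ Y = -(linearCoord M X Y * X) := by
  have h : X⁻¹ ^ (2 * M + 1) - 1 = -(X ^ (2 * M + 1) - 1) / X ^ (2 * M + 1) := by
    rw [inv_pow, neg_sub, sub_div, div_self (pow_ne_zero _ hX), one_div]
  rw [linearCoord, linearCoord, h, inv_pow]
  generalize (Y - 1) / (Y + 1) = Z
  generalize hW : X ^ (2 * M + 1) - 1 = W at *
  field_simp
  ring

/-- The Cayley transform (Y-1)/(Y+1) is odd under Y ↦ 1/Y. -/
theorem linearCoord_inv_right (M : ℕ) (X : k) {Y : k} (hY : Y ≠ 0) :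
    linearCoord M X Y⁻¹ = -linearCoord M X Y := by
  have h : (Y⁻¹ - 1) / (Y⁻¹ + 1) = -((Y - 1) / (Y + 1)) := by
    rw [← mul_div_mul_left _ _ hY, mul_sub, mul_add, mul_inv_cancel₀ hY, mul_one, ← neg_div,
      neg_sub, add_comm 1 Y]
  rw [linearCoord, linearCoord, h]
  ring

/-- A group acting on the toric coordinates `X = x ^ p * y ^ q` and `Y = x ^ r * y ^ s` by
`X ↦ η * X ^ (± 1)`, `Y ↦ Y ^ (± 1)`, where the `η` are roots of unity of a fixed odd order, is
linearizable. -/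
theorem isLinearizable_of_monomial_action [CharZero k] (γ₁ γ₂ : GL (Fin 2) k) {p q r s : ℤ}
    (h : p * s - q * r = 1) (M : ℕ) {G : Subgroup (PGL(2, k) × PGL(2, k))}
    (hG : ∀ g ∈ G, ∃ (η : k) (ε ε' : ℤ), η ^ (2 * M + 1) = 1 ∧ (ε = 1 ∨ ε = -1) ∧
      (ε' = 1 ∨ ε' = -1) ∧ ∀ z ∈ quadricTorus γ₁ γ₂,
        quadricMonomial γ₁ γ₂ p q (Quadric.act g z) = η * quadricMonomial γ₁ γ₂ p q z ^ ε ∧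
        quadricMonomial γ₁ γ₂ r s (Quadric.act g z) = quadricMonomial γ₁ γ₂ r s z ^ ε') :
    IsLinearizable G := by
  refine ⟨linearization γ₁ γ₂ p q r s h M, isBirational_linearization γ₁ γ₂ h M, ?_⟩
  intro g hg
  obtain ⟨η, ε, ε', hη, hε, hε', H⟩ := hG g hg
  have hη0 : η ≠ 0 := by
    rintro rfl
    simp at hη
  obtain ⟨σ, hσ0, hσ⟩ : ∃ σ : k, σ ≠ 0 ∧
      ∀ X Y : k, Y ≠ 0 → linearCoord M X (Y ^ ε') = σ * linearCoord M X Y := by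
    rcases hε' with rfl | rfl
    · exact ⟨1, one_ne_zero, by simp⟩
    · exact ⟨-1, by simp, fun X Y hY => by
        rw [_root_.zpow_neg_one, linearCoord_inv_right M X hY, neg_one_mul]⟩
  rcases hε with rfl | rfl
  · obtain ⟨A, hA⟩ := exists_smul_ofAff_eq_diagonal (c := σ * η ^ (M + 1)) (d := σ * η ^ M)
      (mul_ne_zero hσ0 (pow_ne_zero _ hη0)) (mul_ne_zero hσ0 (pow_ne_zero _ hη0))
    refine ⟨A, fun z hz _ => ?_⟩
    obtain ⟨h1, h2⟩ := H z hz.1.1.1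
    change linearizationFun _ _ _ _ _ _ _ _ = A • linearizationFun _ _ _ _ _ _ _ _
    rw [linearizationFun, linearizationFun, hA, h1, h2,
      hσ _ _ (quadricMonomial_ne_zero hz.1.1.1 r s), zpow_one, linearCoord_mul_left M hη]
    congr 1 <;> ring
  -- Inverting X sends b to -a, whence the minus signs; the new first coordinate is ηX⁻¹ times the
  -- new second one.
  · obtain ⟨A, hA⟩ := exists_smul_ofAff_eq_swap (c := -(σ * η ^ (M + 1))) (d := -(σ * η ^ M))
      (neg_ne_zero.2 (mul_ne_zero hσ0 (pow_ne_zero _ hη0)))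
      (neg_ne_zero.2 (mul_ne_zero hσ0 (pow_ne_zero _ hη0)))
    refine ⟨A, fun z hz _ => ?_⟩
    obtain ⟨h1, h2⟩ := H z hz.1.1.1
    have hX := quadricMonomial_ne_zero hz.1.1.1 p q
    change linearizationFun _ _ _ _ _ _ _ _ = A • linearizationFun _ _ _ _ _ _ _ _
    rw [linearizationFun, linearizationFun, hA, h1, h2,
      hσ _ _ (quadricMonomial_ne_zero hz.1.1.1 r s), _root_.zpow_neg_one, linearCoord_mul_left M hη,
      linearCoord_inv_left M hX hz.1.1.2]
    congr 1
    · field_simp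
      ring
    · ring

end PlaneAction

/-! ### Dihedral groups and roots of unity. -/

section Dihedral

open DihedralGroup

variable {k : Type*} [Field k]

/-- The common sign ε in both factors is what lets g send every monomial to a multiple of its own
ε-th power. -/
theorem ActsAs.quadricMonomial_act {γ₁ γ₂ : GL (Fin 2) k} {g : PGL(2, k) × PGL(2, k)} {a b : k}
    {ε : ℤ} (h₁ : ActsAs γ₁ g.1 a ε) (h₂ : ActsAs γ₂ g.2 b ε) (i j : ℤ) {z : Quadric k}
    (hz : z ∈ quadricTorus γ₁ γ₂) :
    quadricMonomial γ₁ γ₂ i j (Quadric.act g z) =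
      a ^ i * b ^ j * quadricMonomial γ₁ γ₂ i j z ^ ε := by
  rw [quadricMonomial, Quadric.act, (h₁ _ hz.1).2, (h₂ _ hz.2).2, quadricMonomial]
  simp only [mul_zpow, ← zpow_mul]
  rw [mul_comm ε i, mul_comm ε j]
  ring

theorem exists_actsAs_of_dihedralGroup_hom [IsAlgClosed k] [CharZero k] {N : ℕ} [NeZero N]
    (φ : DihedralGroup N →* PGL(2, k)) {n : ℕ} (hn : Odd n) (hr : φ (r 1) ^ n = 1)
    (hs : φ (sr 0) ≠ 1) :
    ∃ (γ : GL (Fin 2) k) (ζ : k), ζ ^ n = 1 ∧ ∀ i : ZMod N,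
      ActsAs γ (φ (r i)) (ζ ^ i.val) 1 ∧ ActsAs γ (φ (sr i)) (ζ ^ i.val)⁻¹ (-1) := by
  obtain ⟨γ, ζ, hζ, hR, hS⟩ := exists_actsAs_dihedral hn hr
    (by rw [← map_mul, sr_mul_self, map_one]) hs
    (by rw [← map_mul, ← map_mul, sr_mul_r, sr_mul_self, map_one])
  refine ⟨γ, ζ, hζ, fun i => ?_⟩
  have h1 : ActsAs γ (φ (r i)) (ζ ^ i.val) 1 := by
    have := hR.pow i.val
    rwa [← map_pow, r_one_pow, ZMod.natCast_zmod_val] at this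
  refine ⟨h1, ?_⟩
  have := hS.mul h1
  rwa [← map_mul, sr_mul_r, zero_add, one_mul, one_mul, zpow_neg_one] at this

theorem exists_actsAs_of_mulEquiv_dihedralGroup [IsAlgClosed k] [CharZero k] {n : ℕ} (hn : Odd n)
    {H : Subgroup PGL(2, k)} (f : H ≃* DihedralGroup n) :
    ∃ γ : GL (Fin 2) k, ∀ g ∈ H, ∃ (a : k) (ε : ℤ), a ^ n = 1 ∧ (ε = 1 ∨ ε = -1) ∧
      ActsAs γ g a ε := by
  have : NeZero n := ⟨hn.pos.ne'⟩
  obtain ⟨γ, ζ, hζ, h⟩ := exists_actsAs_of_dihedralGroup_hom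
    (H.subtype.comp f.symm.toMonoidHom) hn
    (by rw [← map_pow, r_one_pow_n, map_one])
    (by
      intro h
      have h' : f.symm (sr 0) = 1 := Subtype.ext h
      rw [map_eq_one_iff f.symm f.symm.injective] at h'
      cases h')
  refine ⟨γ, fun g hg => ?_⟩
  have hfg : ∀ x, f ⟨g, hg⟩ = x → (H.subtype.comp f.symm.toMonoidHom) x = g := by
    rintro _ rfl
    simp
  rcases hx : f ⟨g, hg⟩ with i | i
  · refine ⟨ζ ^ i.val, 1, by rw [← pow_mul, mul_comm, pow_mul, hζ, one_pow], .inl rfl, ?_⟩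
    simpa only [hfg _ hx] using (h i).1
  · refine ⟨(ζ ^ i.val)⁻¹, -1, by rw [inv_pow, ← pow_mul, mul_comm, pow_mul, hζ, one_pow, inv_one],
      .inr rfl, ?_⟩
    simpa only [hfg _ hx] using (h i).2

/-- A surjection between dihedral groups, onto a nonabelian one of odd degree, maps rotations to
rotations and reflections to reflections. -/
theorem surjective_dihedralGroup_hom {N n : ℕ} (hn : Odd n) (hn1 : n ≠ 1)
    (φ : DihedralGroup N →* DihedralGroup n) (hφ : Function.Surjective φ) :
    φ (r 1) ^ n = 1 ∧ φ (sr 0) ≠ 1 := by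
  -- The two images generate the target, which is nonabelian.
  have hcomm : ¬ Commute (φ (r 1)) (φ (sr 0)) := by
    intro hc
    have hrs : ∀ i : ZMod N, ∃ j : ℤ, r i = (r 1 : DihedralGroup N) ^ j := fun i =>
      (ZMod.intCast_surjective i).imp fun j hj => by rw [r_one_zpow, hj]
    have hgen : ∀ x : DihedralGroup N, ∃ (i j : ℤ), φ x = φ (sr 0) ^ i * φ (r 1) ^ j := by
      rintro (i | i)
      · obtain ⟨j, hj⟩ := hrs i
        exact ⟨0, j, by rw [hj, map_zpow, zpow_zero, one_mul]⟩
      · obtain ⟨j, hj⟩ := hrs i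
        refine ⟨1, j, ?_⟩
        rw [zpow_one, ← map_zpow, ← map_mul, ← hj, sr_mul_r, zero_add]
    refine not_commutative hn1 (by rintro rfl; exact absurd hn (by decide)) ⟨⟨fun x y => ?_⟩⟩
    obtain ⟨x, rfl⟩ := hφ x
    obtain ⟨y, rfl⟩ := hφ y
    obtain ⟨i, j, hx⟩ := hgen x
    obtain ⟨i', j', hy⟩ := hgen y
    rw [hx, hy]
    have h1 := (Commute.refl (φ (sr 0))).zpow_zpow i i'
    have h2 := hc.symm.zpow_zpow i j'
    have h3 := hc.zpow_zpow j i'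
    have h4 := (Commute.refl (φ (r 1))).zpow_zpow j j'
    exact (h1.mul_right h2).mul_left (h3.mul_right h4)
  refine ⟨?_, fun h => hcomm (h ▸ Commute.one_right _)⟩
  rcases hx : φ (r 1) with i | i
  · simp
  -- If r 1 went to a reflection, then φ(r 1), φ(sr 0) and their product would all square to 1, so
  -- they would commute.
  · refine absurd ?_ hcomm
    have h1 : φ (sr 0) * φ (r 1) * (φ (sr 0) * φ (r 1)) = 1 := by
      rw [← map_mul, ← map_mul, sr_mul_r, sr_mul_self, map_one]
    have h2 : φ (r 1) * φ (r 1) = 1 := by rw [hx, sr_mul_self]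
    have h3 : φ (sr 0) * φ (sr 0) = 1 := by rw [← map_mul, sr_mul_self, map_one]
    have h4 := eq_inv_of_mul_eq_one_left h1
    rw [mul_inv_rev, ← eq_inv_of_mul_eq_one_left h2, ← eq_inv_of_mul_eq_one_left h3] at h4
    exact h4.symm

/-- Write ζ₁ = ξ^a, ζ₂ = ξ^b. Dividing (-b, a) by gcd(a, b) gives a primitive relation (r, s), and
Bézout completes it to a unimodular matrix. -/
theorem exists_unimodular_of_roots_of_unity [IsAlgClosed k] [CharZero k] {N : ℕ} [NeZero N]
    {ζ₁ ζ₂ : k} (h₁ : ζ₁ ^ N = 1) (h₂ : ζ₂ ^ N = 1) :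
    ∃ p q r s : ℤ, p * s - q * r = 1 ∧ ζ₁ ^ r * ζ₂ ^ s = 1 := by
  have : NeZero (N : k) := ⟨Nat.cast_ne_zero.2 (NeZero.ne N)⟩
  obtain ⟨ξ, hξ⟩ := HasEnoughRootsOfUnity.exists_primitiveRoot k N
  have hξ0 : ξ ≠ 0 := hξ.ne_zero (NeZero.ne N)
  obtain ⟨a, -, rfl⟩ := hξ.eq_pow_of_pow_eq_one h₁
  obtain ⟨b, -, rfl⟩ := hξ.eq_pow_of_pow_eq_one h₂
  obtain ⟨a', b', hab, ha, hb⟩ := Nat.exists_coprime a b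
  obtain ⟨u, v, huv⟩ := Nat.isCoprime_iff_coprime.2 hab
  refine ⟨u, v, -b', a', by linarith, ?_⟩
  rw [← zpow_natCast, ← zpow_natCast, ← zpow_mul, ← zpow_mul, ← zpow_add₀ hξ0]
  rw [show (a : ℤ) * -b' + b * a' = 0 by
    generalize a.gcd b = d at ha hb
    subst ha hb
    push_cast
    ring, zpow_zero]

end Dihedral

/-! ### Projections of a fibre product. -/

section FibreProduct

variable {Γ₁ Γ₂ Q : Type*} [Group Γ₁] [Group Γ₂] [Group Q] {H₁ : Subgroup Γ₁} {H₂ : Subgroup Γ₂}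

theorem mem_fibreProduct {α : H₁ →* Q} {β : H₂ →* Q} {g : Γ₁ × Γ₂} :
    g ∈ fibreProduct α β ↔ ∃ (h₁ : g.1 ∈ H₁) (h₂ : g.2 ∈ H₂), α ⟨g.1, h₁⟩ = β ⟨g.2, h₂⟩ := by
  constructor
  · rintro ⟨x, hx, rfl⟩
    exact ⟨x.1.2, x.2.2, hx⟩
  · rintro ⟨h₁, h₂, h⟩
    exact ⟨(⟨g.1, h₁⟩, ⟨g.2, h₂⟩), h, rfl⟩

/-- The first projection of a fibre product. -/
def fibreProductFst (α : H₁ →* Q) (β : H₂ →* Q) : fibreProduct α β →* H₁ :=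
  ((MonoidHom.fst Γ₁ Γ₂).comp (fibreProduct α β).subtype).codRestrict H₁
    fun g => (mem_fibreProduct.1 g.2).1

/-- The second projection of a fibre product. -/
def fibreProductSnd (α : H₁ →* Q) (β : H₂ →* Q) : fibreProduct α β →* H₂ :=
  ((MonoidHom.snd Γ₁ Γ₂).comp (fibreProduct α β).subtype).codRestrict H₂
    fun g => (mem_fibreProduct.1 g.2).2.1

theorem fibreProductFst_surjective (α : H₁ →* Q) {β : H₂ →* Q} (hβ : Function.Surjective β) :
    Function.Surjective (fibreProductFst α β) := fun h => by
  obtain ⟨h', hh⟩ := hβ (α h)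
  exact ⟨⟨(h, h'), mem_fibreProduct.2 ⟨h.2, h'.2, hh.symm⟩⟩, rfl⟩

theorem fibreProductSnd_surjective {α : H₁ →* Q} (β : H₂ →* Q) (hα : Function.Surjective α) :
    Function.Surjective (fibreProductSnd α β) := fun h => by
  obtain ⟨h', hh⟩ := hα (β h)
  exact ⟨⟨(h', h), mem_fibreProduct.2 ⟨h'.2, h.2, hh⟩⟩, rfl⟩

end FibreProduct

/-! ### Assembling the theorem. -/

open DihedralGroup in
theorem isLinearizable_of_dihedral_projections {k : Type*} [Field k] [IsAlgClosed k] [CharZero k]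
    {n m N : ℕ} [NeZero N] (hn : Odd n) (hm : Odd m) {G : Subgroup (PGL(2, k) × PGL(2, k))}
    (e : DihedralGroup N ≃* G)
    (hr₁ : (e (r 1)).1.1 ^ n = 1) (hs₁ : (e (sr 0)).1.1 ≠ 1)
    (hr₂ : (e (r 1)).1.2 ^ m = 1) (hs₂ : (e (sr 0)).1.2 ≠ 1) : IsLinearizable G := by
  obtain ⟨γ₁, ζ₁, hζ₁, h₁⟩ := exists_actsAs_of_dihedralGroup_hom
    ((MonoidHom.fst _ _).comp (G.subtype.comp e.toMonoidHom)) hn hr₁ hs₁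
  obtain ⟨γ₂, ζ₂, hζ₂, h₂⟩ := exists_actsAs_of_dihedralGroup_hom
    ((MonoidHom.snd _ _).comp (G.subtype.comp e.toMonoidHom)) hm hr₂ hs₂
  have : NeZero (n * m) := ⟨(hn.mul hm).pos.ne'⟩
  have hζ₁' : ζ₁ ^ (n * m) = 1 := by rw [pow_mul, hζ₁, one_pow]
  have hζ₂' : ζ₂ ^ (n * m) = 1 := by rw [mul_comm, pow_mul, hζ₂, one_pow]
  obtain ⟨p, q, r', s, hdet, hrel⟩ := exists_unimodular_of_roots_of_unity hζ₁' hζ₂'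
  -- The odd number nm kills both ζ₁ and ζ₂, so it serves as 2M+1.
  obtain ⟨M, hM⟩ := hn.mul hm
  have hη : ∀ i : ℕ, ((ζ₁ ^ i) ^ p * (ζ₂ ^ i) ^ q) ^ (n * m) = 1 := fun i => by
    have : ∀ (z : k) (l : ℤ), z ^ (n * m) = 1 → ((z ^ i) ^ l) ^ (n * m) = 1 := fun z l hz => by
      rw [← zpow_natCast, zpow_comm, zpow_natCast, ← pow_mul, mul_comm i, pow_mul, hz, one_pow,
        one_zpow]
    rw [mul_pow, this _ _ hζ₁', this _ _ hζ₂', one_mul]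
  have hrel' : ∀ i : ℕ, (ζ₁ ^ i) ^ r' * (ζ₂ ^ i) ^ s = 1 := fun i => by
    simp only [← zpow_natCast]
    rw [zpow_comm, zpow_comm ζ₂, ← mul_zpow, hrel, one_zpow]
  refine isLinearizable_of_monomial_action γ₁ γ₂ hdet M fun g hg => ?_
  rw [← hM]
  obtain ⟨x, hx⟩ := e.surjective ⟨g, hg⟩
  obtain rfl : (e x).1 = g := congrArg Subtype.val hx
  rcases x with i | i
  · refine ⟨_, 1, 1, hη i.val, .inl rfl, .inl rfl, fun z hz => ⟨?_, ?_⟩⟩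
    · exact ActsAs.quadricMonomial_act (h₁ i).1 (h₂ i).1 p q hz
    · refine (ActsAs.quadricMonomial_act (h₁ i).1 (h₂ i).1 r' s hz).trans ?_
      rw [hrel', one_mul]
  · refine ⟨((ζ₁ ^ i.val) ^ p * (ζ₂ ^ i.val) ^ q)⁻¹, -1, -1, by rw [inv_pow, hη, inv_one],
      .inr rfl, .inr rfl, fun z hz => ⟨?_, ?_⟩⟩
    · refine (ActsAs.quadricMonomial_act (h₁ i).2 (h₂ i).2 p q hz).trans ?_
      rw [inv_zpow, inv_zpow, mul_inv]
    · refine (ActsAs.quadricMonomial_act (h₁ i).2 (h₂ i).2 r' s hz).trans ?_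
      rw [inv_zpow, inv_zpow, ← mul_inv, hrel', inv_one, one_mul]

theorem mainTheorem10 {k : Type*} [Field k] [IsAlgClosed k] [CharZero k]
    (n m : ℕ) (hn : Odd n) (hm : Odd m)
    (H₁ H₂ : Subgroup PGL(2, k))
    (hH₁ : Nonempty (H₁ ≃* DihedralGroup n)) (hH₂ : Nonempty (H₂ ≃* DihedralGroup m))
    {Q : Type*} [Group Q] (α : H₁ →* Q) (β : H₂ →* Q)
    (hα : Function.Surjective α) (hβ : Function.Surjective β)
    (hG : IsDihedral (fibreProduct α β)) :
    IsLinearizable (fibreProduct α β) := by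
  obtain ⟨f₁⟩ := hH₁
  obtain ⟨f₂⟩ := hH₂
  by_cases hnm : n = 1 ∨ m = 1
  · obtain ⟨γ₁, h₁⟩ := exists_actsAs_of_mulEquiv_dihedralGroup hn f₁
    obtain ⟨γ₂, h₂⟩ := exists_actsAs_of_mulEquiv_dihedralGroup hm f₂
    rcases hnm with rfl | rfl
    · obtain ⟨M, rfl⟩ := hm
      -- X = y and Y = 1/x: the coordinate of the factor of order 2 must be Y, and inverting it
      -- makes the determinant 1.
      refine isLinearizable_of_monomial_action γ₁ γ₂ (p := 0) (q := 1) (r := -1) (s := 0)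
        (by norm_num) M fun g hg => ?_
      obtain ⟨hg₁, hg₂, -⟩ := mem_fibreProduct.1 hg
      obtain ⟨a, ε, ha, hε, h₁⟩ := h₁ _ hg₁
      obtain ⟨b, ε', hb, hε', h₂⟩ := h₂ _ hg₂
      obtain rfl : a = 1 := by simpa using ha
      refine ⟨b, ε', ε, hb, hε', hε, fun z hz => ?_⟩
      simp [quadricMonomial, Quadric.act, (h₁ _ hz.1).2, (h₂ _ hz.2).2]
    · obtain ⟨M, rfl⟩ := hn
      refine isLinearizable_of_monomial_action γ₁ γ₂ (p := 1) (q := 0) (r := 0) (s := 1)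
        (by norm_num) M fun g hg => ?_
      obtain ⟨hg₁, hg₂, -⟩ := mem_fibreProduct.1 hg
      obtain ⟨a, ε, ha, hε, h₁⟩ := h₁ _ hg₁
      obtain ⟨b, ε', hb, hε', h₂⟩ := h₂ _ hg₂
      obtain rfl : b = 1 := by simpa using hb
      refine ⟨a, ε, ε', ha, hε, hε', fun z hz => ?_⟩
      simp [quadricMonomial, Quadric.act, (h₁ _ hz.1).2, (h₂ _ hz.2).2]
  · push Not at hnm
    obtain ⟨N, hN, ⟨e⟩⟩ := hG
    have : NeZero N := ⟨by omega⟩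
    obtain ⟨hr₁, hs₁⟩ := surjective_dihedralGroup_hom hn hnm.1
      (f₁.toMonoidHom.comp ((fibreProductFst α β).comp e.symm.toMonoidHom))
      (f₁.surjective.comp ((fibreProductFst_surjective α hβ).comp e.symm.surjective))
    obtain ⟨hr₂, hs₂⟩ := surjective_dihedralGroup_hom hm hnm.2
      (f₂.toMonoidHom.comp ((fibreProductSnd α β).comp e.symm.toMonoidHom))
      (f₂.surjective.comp ((fibreProductSnd_surjective β hα).comp e.symm.surjective))
    simp only [MonoidHom.comp_apply, MulEquiv.toMonoidHom_eq_coe, MonoidHom.coe_coe, ← map_pow,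
      EmbeddingLike.map_eq_one_iff, ne_eq] at hr₁ hs₁ hr₂ hs₂
    refine isLinearizable_of_dihedral_projections hn hm e.symm ?_ ?_ ?_ ?_
    · rw [map_pow, map_pow] at hr₁
      exact congrArg Subtype.val hr₁
    · exact fun h => hs₁ (Subtype.ext h)
    · rw [map_pow, map_pow] at hr₂
      exact congrArg Subtype.val hr₂
    · exact fun h => hs₂ (Subtype.ext h)
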